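/- Let $\alpha_1,\alpha_2,\alpha_3,\beta$ be the $4\times 4$ Dirac matrices $$\alpha_j=\begin{pmatrix}0&\sigma_j\\ \sigma_j&0\end{pmatrix},\qquad \beta=\begin{pmatrix}I_2&0\\0&-I_2\end{pmatrix},$$ where $\sigma_1=\begin{pmatrix}0&1\\1&0\end{pmatrix}$, $\sigma_2=\begin{pmatrix}0&-i\\i&0\end{pmatrix}$, $\sigma_3=\begin{pmatrix}1&0\\0&-1\end{pmatrix}$ are the Pauli matrices. For $m>0$ let $$H_m=\sum_{j=1}^3\alpha_j\,\tfrac1i\partial_{x_j}+m\beta$$ be the free Dirac operator in $L^2(\mathbb R^3,\mathbb C^4)$, with domain the Sobolev space $H^1(\mathbb R^3,\mathbb C^4)$. Let $m>0$ and $s>1$. For every $u_0\in L^2(\mathbb R^3,\mathbb C^4)$ the Cauchy problem $$i\,\partial_t u=H_m u\quad(t\in\mathbb R),\qquad u(\cdot,0)=u_0,$$ has exactly one (mild) solution $u=e^{-itH_m}u_0$, that is, exactly one continuous $u:\mathbb R\to L^2(\mathbb R^3,\mathbb C^4)$ with $u(0)=u_0$ such that for every $t\in\mathbb R$ one has $\int_0^t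 u(\tau)\,d\tau\in H^1(\mathbb R^3,\mathbb C^4)$ and $i\,(u(t)-u_0)=H_m\int_0^t u(\tau)\,d\tau$. Moreover, there is a constant $C=C_{s,m}>0$, depending only on $s$ and $m$, such that for every $u_0\in L^2(\mathbb R^3,\mathbb C^4)$ this solution satisfies $$\int_{\mathbb R}\int_{\mathbb R^3}(1+|x|^2)^{-s}\,|u(x,t)|^2\,dx\,dt\;\le\; C\,\|u_0\|_{L^2(\mathbb R^3,\mathbb C^4)}^2 .$$ -/

import Mathlib

open MeasureTheory TemperedDistribution
open scoped SchwartzMap LineDeriv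

noncomputable section

namespace FreeDirac

/-- Physical space `ℝ³` with its Euclidean norm and Lebesgue measure. -/
abbrev Space : Type := EuclideanSpace ℝ (Fin 3)

/-- The spinor space `ℂ⁴` with its Hermitian norm. -/
abbrev Spinor : Type := EuclideanSpace ℂ (Fin 4)

/-- The Hilbert space `L²(ℝ³, ℂ⁴)`. -/
abbrev L2 : Type := Lp Spinor 2 (volume : Measure Space)

/-- The Dirac matrices `α₁, α₂, α₃` (indexed by `0, 1, 2`), with off-diagonal `2 × 2` blocks equal
to the Pauli matrices and vanishing diagonal blocks. -/
def alpha : Fin 3 → Matrix (Fin 4) (Fin 4) ℂ :=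
  ![!![0, 0, 0, 1;
       0, 0, 1, 0;
       0, 1, 0, 0;
       1, 0, 0, 0],
    !![0, 0, 0, -Complex.I;
       0, 0, Complex.I, 0;
       0, -Complex.I, 0, 0;
       Complex.I, 0, 0, 0],
    !![0, 0, 1, 0;
       0, 0, 0, -1;
       1, 0, 0, 0;
       0, -1, 0, 0]]

/-- The Dirac matrix `β = diag(I₂, -I₂)`. -/
def beta : Matrix (Fin 4) (Fin 4) ℂ :=
  !![1, 0, 0, 0;
     0, 1, 0, 0;
     0, 0, -1, 0;
     0, 0, 0, -1]

/-- Pointwise action of a constant `4 × 4` matrix on `L²(ℝ³, ℂ⁴)`: `(A f)(x) = A (f x)`. -/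
def matrixAct (A : Matrix (Fin 4) (Fin 4) ℂ) : L2 →L[ℂ] L2 :=
  (Matrix.toEuclideanCLM (𝕜 := ℂ) A).compLpL 2 (volume : Measure Space)

/-- An `L²` function is determined by the tempered distribution that it defines. -/
theorem toTemperedDistribution_injective {f g : L2}
    (h : (f : 𝓢'(Space, Spinor)) = (g : 𝓢'(Space, Spinor))) : f = g := by
  have hk := Lp.ker_toTemperedDistributionCLM_eq_bot (F := Spinor)
    (μ := (volume : Measure Space)) (p := 2)
  exact LinearMap.ker_eq_bot.mp hk h

/-- The Sobolev space `H¹(ℝ³, ℂ⁴)`, as a subspace of `L²(ℝ³, ℂ⁴)`. -/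
def sobolevH1 : Submodule ℂ L2 where
  carrier := {f | MemSobolev 1 2 (f : 𝓢'(Space, Spinor))}
  zero_mem' := by
    have h : ((0 : L2) : 𝓢'(Space, Spinor)) = 0 :=
      (Lp.toTemperedDistributionCLM Spinor (volume : Measure Space) 2).map_zero
    rw [Set.mem_ofPred_eq, h]
    exact memSobolev_fun_zero Space Spinor 1 2
  add_mem' := by
    intro f g hf hg
    have h : ((f + g : L2) : 𝓢'(Space, Spinor)) = (f : 𝓢'(Space, Spinor)) + g :=
      (Lp.toTemperedDistributionCLM Spinor (volume : Measure Space) 2).map_add f g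
    rw [Set.mem_ofPred_eq, h]
    exact MemSobolev.add hf hg
  smul_mem' := by
    intro c f hf
    have h : ((c • f : L2) : 𝓢'(Space, Spinor)) = c • (f : 𝓢'(Space, Spinor)) :=
      (Lp.toTemperedDistributionCLM Spinor (volume : Measure Space) 2).map_smul c f
    rw [Set.mem_ofPred_eq, h]
    exact MemSobolev.smul c hf

/-- The distributional partial derivatives of an `H¹` function are `L²` functions. -/
theorem exists_weakDeriv (j : Fin 3) (f : sobolevH1) :
    ∃ g : L2, (g : 𝓢'(Space, Spinor))
      = ∂_{(EuclideanSpace.single j (1 : ℝ) : Space)} ((f : L2) : 𝓢'(Space, Spinor)) := by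
  have h : MemSobolev (1 - 1) 2
      (∂_{(EuclideanSpace.single j (1 : ℝ) : Space)} ((f : L2) : 𝓢'(Space, Spinor))) :=
    MemSobolev.lineDerivOp f.2
  rw [sub_self, memSobolev_zero_iff] at h
  obtain ⟨g, hg⟩ := h
  exact ⟨g, hg.symm⟩

/-- The `j`-th distributional partial derivative of an `H¹` function, as an `L²` function. -/
def weakDerivFun (j : Fin 3) (f : sobolevH1) : L2 := (exists_weakDeriv j f).choose

theorem weakDerivFun_spec (j : Fin 3) (f : sobolevH1) :
    (weakDerivFun j f : 𝓢'(Space, Spinor))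
      = ∂_{(EuclideanSpace.single j (1 : ℝ) : Space)} ((f : L2) : 𝓢'(Space, Spinor)) :=
  (exists_weakDeriv j f).choose_spec

/-- The partial derivative `∂ⱼ : H¹(ℝ³, ℂ⁴) → L²(ℝ³, ℂ⁴)` as a linear map. -/
def weakDeriv (j : Fin 3) : sobolevH1 →ₗ[ℂ] L2 where
  toFun := weakDerivFun j
  map_add' := by
    intro f g
    apply toTemperedDistribution_injective
    have h1 : ((weakDerivFun j f + weakDerivFun j g : L2) : 𝓢'(Space, Spinor))
        = (weakDerivFun j f : 𝓢'(Space, Spinor)) + weakDerivFun j g :=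
      (Lp.toTemperedDistributionCLM Spinor (volume : Measure Space) 2).map_add _ _
    have h2 : (((f + g : sobolevH1) : L2) : 𝓢'(Space, Spinor))
        = ((f : L2) : 𝓢'(Space, Spinor)) + (g : L2) :=
      (Lp.toTemperedDistributionCLM Spinor (volume : Measure Space) 2).map_add _ _
    rw [h1, weakDerivFun_spec, weakDerivFun_spec, weakDerivFun_spec, h2,
      LineDeriv.lineDerivOp_add]
  map_smul' := by
    intro c f
    apply toTemperedDistribution_injective
    have h1 : ((c • weakDerivFun j f : L2) : 𝓢'(Space, Spinor))
        = c • (weakDerivFun j f : 𝓢'(Space, Spinor)) :=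
      (Lp.toTemperedDistributionCLM Spinor (volume : Measure Space) 2).map_smul _ _
    have h2 : (((c • f : sobolevH1) : L2) : 𝓢'(Space, Spinor))
        = c • ((f : L2) : 𝓢'(Space, Spinor)) :=
      (Lp.toTemperedDistributionCLM Spinor (volume : Measure Space) 2).map_smul _ _
    rw [RingHom.id_apply, h1, weakDerivFun_spec, weakDerivFun_spec, h2,
      LineDeriv.lineDerivOp_smul]

/-- The free Dirac operator `H_m = α · D + m β`, `D = (1/i) ∇`, as an unbounded operator in
`L²(ℝ³, ℂ⁴)` with domain `H¹(ℝ³, ℂ⁴)`. -/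
def diracOperator (m : ℝ) : L2 →ₗ.[ℂ] L2 where
  domain := sobolevH1
  toFun := (∑ j : Fin 3, (1 / Complex.I) • ((matrixAct (alpha j) : L2 →ₗ[ℂ] L2) ∘ₗ weakDeriv j))
    + (m : ℂ) • ((matrixAct beta : L2 →ₗ[ℂ] L2) ∘ₗ sobolevH1.subtype)

theorem diracOperator_apply (m : ℝ) (f : sobolevH1) :
    diracOperator m f = (∑ j : Fin 3, (1 / Complex.I) • matrixAct (alpha j) (weakDeriv j f))
      + (m : ℂ) • matrixAct beta f := by
  change ((∑ j : Fin 3, (1 / Complex.I) • ((matrixAct (alpha j) : L2 →ₗ[ℂ] L2) ∘ₗ weakDeriv j))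
    + (m : ℂ) • ((matrixAct beta : L2 →ₗ[ℂ] L2) ∘ₗ sobolevH1.subtype)) f = _
  rw [LinearMap.add_apply, LinearMap.sum_apply]
  rfl

/-- `u` is the (mild) solution of the Cauchy problem `i uₜ = H_m u`, `u(0) = u₀`, for data
`u₀ ∈ L²(ℝ³, ℂ⁴)`: it is a continuous `L²`-valued function with `u 0 = u₀` that satisfies the
equation integrated in time, i.e. for every `t` the integral `∫₀ᵗ u` lies in the domain of `H_m`
and `i (u t - u₀) = H_m ∫₀ᵗ u`. These are the orbits `u t = exp (-i t H_m) u₀`. -/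
structure IsDiracSolution (m : ℝ) (u₀ : L2) (u : ℝ → L2) : Prop where
  continuous : Continuous u
  initial : u 0 = u₀
  equation : ∀ t : ℝ,
    ∃ h : (∫ τ in (0 : ℝ)..t, u τ) ∈ (diracOperator m).domain,
      Complex.I • (u t - u₀) = diracOperator m ⟨∫ τ in (0 : ℝ)..t, u τ, h⟩

end FreeDirac

end

noncomputable section

namespace FreeDirac

open scoped BoundedContinuousFunction InnerProductSpace FourierTransform ENNReal ComplexConjugate

/-! ### Multiplication operators on `L²` -/

/-! The Fourier transform turns `H_m` into multiplication by a Hermitian matrix `D(ξ)` with `D(ξ)² =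
E(ξ)²`, where `E(ξ) = √(4π²|ξ|² + m²) ≥ m > 0`. Hence `H_m` has a bounded symmetric inverse `B`, and
the mild equation is equivalent to `∫₀ᵗ u = B(i(u(t) - u₀))`. If `W` is the time integral of the
difference of two solutions, then `B W' = -i W`, so `‖B W‖²` is constant, hence zero; this gives
uniqueness. For existence, `D/E` squares to the identity, and splitting `u₀` along its eigenspaces
`±1` gives the solution as a sum of two parts that evolve by the scalar phases `exp(∓itE)`.

The estimate is a `TT*` argument for `f ↦ ∫ exp(i(2π x·ξ - tE(ξ))) f(ξ) dξ`, with the weight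
`exp(-εt²) exp(-l|x|²)`. The kernel of `T*T` is explicit: a Gaussian in `E(η) - E(ξ)` of width about
`√ε`, times a Gaussian in `η - ξ` of width about `√l` (`integral_planeWave_mul_conj`). By Schur's
test one needs its integral in `η`, uniformly in `ξ` and `ε`. Disintegrating over the spheres `E =
τ` reduces this to bounding the Gaussian mass of a sphere, uniformly in its radius
(`lintegral_level_le`, `lintegral_gaussian_energy_le`). The powers of `ε` cancel, so `ε → 0` is
harmless, and the resulting bound is `C/l` for `0 < l ≤ 1`.

Finally `(1 + |x|²)^(-s)` is dominated by a constant times `∑ₖ 4^(-sk) exp(-4^(-k)|x|²)`. The `k`-th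
Gaussian costs a multiple of `4^k`, so the total is a geometric series of ratio `4^(1-s)`,
convergent because `s > 1`. -/

/-- Bounded continuous operator-valued functions. -/
abbrev Symbol : Type := Space →ᵇ (Spinor →L[ℂ] Spinor)

/-- Multiplication by a bounded continuous operator-valued function. -/
def multiplier (A : Symbol) : L2 →L[ℂ] L2 :=
  (ContinuousLinearMap.id ℂ (Spinor →L[ℂ] Spinor)).holderL volume ⊤ 2 2 (A.memLp_top.toLp A)

theorem coeFn_multiplier (A : Symbol) (f : L2) :
    multiplier A f =ᵐ[volume] fun x ↦ A x (f x) := by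
  filter_upwards [ContinuousLinearMap.coeFn_holder (r := 2)
    (ContinuousLinearMap.id ℂ (Spinor →L[ℂ] Spinor)) ((A.memLp_top (μ := volume)).toLp A) f,
    (A.memLp_top (μ := volume)).coeFn_toLp] with x h1 h2
  rw [← h2]
  exact h1

theorem multiplier_mul (A B : Symbol) (f : L2) :
    multiplier (A * B) f = multiplier A (multiplier B f) := by
  apply Lp.ext
  filter_upwards [coeFn_multiplier (A * B) f, coeFn_multiplier A (multiplier B f),
    coeFn_multiplier B f] with x h1 h2 h3
  rw [h1, h2, h3]
  rfl

theorem multiplier_add (A B : Symbol) (f : L2) :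
    multiplier (A + B) f = multiplier A f + multiplier B f := by
  apply Lp.ext
  filter_upwards [coeFn_multiplier (A + B) f, coeFn_multiplier A f,
    coeFn_multiplier B f, Lp.coeFn_add (multiplier A f) (multiplier B f)] with x h1 h2 h3 h4
  rw [h1, h4, Pi.add_apply, h2, h3]
  rfl

theorem multiplier_smul (c : ℂ) (A : Symbol) (f : L2) :
    multiplier (c • A) f = c • multiplier A f := by
  apply Lp.ext
  filter_upwards [coeFn_multiplier (c • A) f, coeFn_multiplier A f,
    Lp.coeFn_smul c (multiplier A f)] with x h1 h2 h3
  rw [h1, h3, Pi.smul_apply, h2]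
  rfl

theorem multiplier_one (f : L2) : multiplier 1 f = f := by
  apply Lp.ext
  filter_upwards [coeFn_multiplier 1 f] with x h1
  rw [h1]
  rfl

theorem norm_multiplier_apply_le (A : Symbol) {C : ℝ} (h : ∀ x, ‖A x‖ ≤ C) (f : L2) :
    ‖multiplier A f‖ ≤ C * ‖f‖ := by
  apply Lp.norm_le_mul_norm_of_ae_le_mul
  filter_upwards [coeFn_multiplier A f] with x h1
  rw [h1]
  exact (A x).le_of_opNorm_le (h x) _

/-! ### Symbols of the Dirac operator -/

/-- The matrix `∑ⱼ 2π ξⱼ αⱼ + m β`. -/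
def diracSymbol (m : ℝ) (ξ : Space) : Spinor →L[ℂ] Spinor :=
  ∑ j : Fin 3, ((2 * Real.pi * ξ j : ℝ) : ℂ) • Matrix.toEuclideanCLM (𝕜 := ℂ) (alpha j)
    + (m : ℂ) • Matrix.toEuclideanCLM (𝕜 := ℂ) beta

/-- The energy `√(4π²|ξ|² + m²)`. -/
def energy (m : ℝ) (ξ : Space) : ℝ := √((2 * Real.pi) ^ 2 * ‖ξ‖ ^ 2 + m ^ 2)

theorem energy_sq (m : ℝ) (ξ : Space) :
    energy m ξ ^ 2 = (2 * Real.pi) ^ 2 * ‖ξ‖ ^ 2 + m ^ 2 :=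
  Real.sq_sqrt (by positivity)

theorem le_energy {m : ℝ} (ξ : Space) : m ≤ energy m ξ :=
  Real.le_sqrt_of_sq_le (le_add_of_nonneg_left (by positivity))

theorem energy_pos {m : ℝ} (hm : 0 < m) (ξ : Space) : 0 < energy m ξ := hm.trans_le (le_energy ξ)

theorem norm_le_energy (m : ℝ) (ξ : Space) : ‖ξ‖ ≤ energy m ξ := by
  apply Real.le_sqrt_of_sq_le
  have h : 1 ≤ (2 * Real.pi) ^ 2 := one_le_pow₀ (by linarith [Real.pi_gt_three])
  nlinarith [mul_le_mul_of_nonneg_right h (sq_nonneg ‖ξ‖), sq_nonneg m]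

@[fun_prop]
theorem continuous_energy (m : ℝ) : Continuous (energy m) := by
  unfold energy
  fun_prop

@[fun_prop]
theorem continuous_diracSymbol (m : ℝ) : Continuous (diracSymbol m) := by
  unfold diracSymbol
  fun_prop

theorem diracSymbol_eq (m : ℝ) (ξ : Space) :
    diracSymbol m ξ = Matrix.toEuclideanCLM (𝕜 := ℂ)
      (∑ j : Fin 3, ((2 * Real.pi * ξ j : ℝ) : ℂ) • alpha j + (m : ℂ) • beta) := by
  simp only [diracSymbol, map_add, map_sum, map_smul]

/-- These are the Clifford relations: the four matrices square to the identity and anticommute, so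
all cross terms cancel. The identity is checked entry by entry. -/
theorem diracSymbol_mul_self (m : ℝ) (ξ : Space) :
    diracSymbol m ξ * diracSymbol m ξ = ((energy m ξ ^ 2 : ℝ) : ℂ) • 1 := by
  rw [diracSymbol_eq, ← map_mul,
    ← map_one (Matrix.toEuclideanCLM (𝕜 := ℂ) (n := Fin 4)), ← map_smul, energy_sq,
    EuclideanSpace.real_norm_sq_eq]
  congr 1
  ext i j
  fin_cases i <;> fin_cases j <;>
  · simp [alpha, beta, Fin.sum_univ_succ, Matrix.mul_apply]
    try ring_nf
    try simp
    try ring_nf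

theorem star_diracSymbol (m : ℝ) (ξ : Space) : star (diracSymbol m ξ) = diracSymbol m ξ := by
  rw [diracSymbol_eq, ← map_star]
  congr 1
  ext i j
  fin_cases i <;> fin_cases j <;>
    simp [alpha, beta, Fin.sum_univ_succ, Matrix.star_apply]

theorem inner_diracSymbol (m : ℝ) (ξ : Space) (v w : Spinor) :
    ⟪diracSymbol m ξ v, w⟫_ℂ = ⟪v, diracSymbol m ξ w⟫_ℂ := by
  conv_rhs => rw [← star_diracSymbol, ContinuousLinearMap.star_eq_adjoint,
    ContinuousLinearMap.adjoint_inner_right]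

/-- A Hermitian matrix with square `E²` is `E` times a unitary. -/
theorem norm_diracSymbol_apply (m : ℝ) (ξ : Space) (v : Spinor) :
    ‖diracSymbol m ξ v‖ = energy m ξ * ‖v‖ := by
  have h : ⟪diracSymbol m ξ v, diracSymbol m ξ v⟫_ℂ = ((energy m ξ * ‖v‖) ^ 2 : ℝ) := by
    rw [inner_diracSymbol, ← mul_apply_eq_comp, diracSymbol_mul_self]
    simp [inner_self_eq_norm_sq_to_K, mul_pow]
  rw [inner_self_eq_norm_sq_to_K] at h
  have h' : ‖diracSymbol m ξ v‖ ^ 2 = (energy m ξ * ‖v‖) ^ 2 :=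
    Complex.ofReal_injective ((Complex.ofReal_pow _ _).trans h)
  exact (pow_left_inj₀ (norm_nonneg _) (mul_nonneg (Real.sqrt_nonneg _) (norm_nonneg _))
    two_ne_zero).mp h'

theorem norm_diracSymbol_le (m : ℝ) (ξ : Space) : ‖diracSymbol m ξ‖ ≤ energy m ξ :=
  ContinuousLinearMap.opNorm_le_bound _ (Real.sqrt_nonneg _)
    fun v ↦ (norm_diracSymbol_apply m ξ v).le

/-- Scalar symbols. -/
def scalarSymbol (c : Space → ℂ) (hc : Continuous c) (C : ℝ) (hC : ∀ x, ‖c x‖ ≤ C) : Symbol :=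
  BoundedContinuousFunction.ofNormedAddCommGroup (fun x ↦ c x • (1 : Spinor →L[ℂ] Spinor))
    (by fun_prop) C (fun x ↦ by rw [norm_smul, norm_one, mul_one]; exact hC x)

theorem scalarSymbol_apply {c : Space → ℂ} {hc : Continuous c} {C : ℝ} {hC : ∀ x, ‖c x‖ ≤ C}
    (x : Space) (v : Spinor) : scalarSymbol c hc C hC x v = c x • v := rfl

/-- The symbol of `exp (-i t √(-Δ + m²))`. -/
def phaseSymbol (m t : ℝ) : Symbol :=
  scalarSymbol (fun ξ ↦ Complex.exp (-(t * energy m ξ : ℝ) * Complex.I)) (by fun_prop) 1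
    (fun ξ ↦ by rw [← Complex.ofReal_neg, Complex.norm_exp_ofReal_mul_I])

/-- The symbol of the sign of the Dirac operator. -/
def signSymbol (m : ℝ) (hm : 0 < m) : Symbol :=
  BoundedContinuousFunction.ofNormedAddCommGroup
    (fun ξ ↦ ((energy m ξ : ℂ)⁻¹) • diracSymbol m ξ)
    (by
      have (ξ : Space) : (energy m ξ : ℂ) ≠ 0 := by exact_mod_cast (energy_pos hm ξ).ne'
      fun_prop (disch := assumption)) 1
    (fun ξ ↦ by
      have := energy_pos hm ξ
      rw [norm_smul, norm_inv, Complex.norm_real, Real.norm_of_nonneg this.le,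
        inv_mul_le_iff₀ this, mul_one]
      exact norm_diracSymbol_le m ξ)

/-- The symbol of `(-Δ + m²)^(-1/2)`. -/
def invEnergySymbol (m : ℝ) (hm : 0 < m) : Symbol :=
  scalarSymbol (fun ξ ↦ (energy m ξ : ℂ)⁻¹)
    (by
      have (ξ : Space) : (energy m ξ : ℂ) ≠ 0 := by exact_mod_cast (energy_pos hm ξ).ne'
      fun_prop (disch := assumption)) m⁻¹
    (fun ξ ↦ by
      have := energy_pos hm ξ
      rw [norm_inv, Complex.norm_real, Real.norm_of_nonneg this.le]
      exact inv_anti₀ hm (le_energy ξ))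

theorem signSymbol_mul_self {m : ℝ} (hm : 0 < m) : signSymbol m hm * signSymbol m hm = 1 := by
  ext1 ξ
  change (((energy m ξ : ℂ)⁻¹) • diracSymbol m ξ) * (((energy m ξ : ℂ)⁻¹) • diracSymbol m ξ) = 1
  have : (energy m ξ : ℂ) ≠ 0 := by exact_mod_cast (energy_pos hm ξ).ne'
  rw [smul_mul_smul_comm, diracSymbol_mul_self, smul_smul]
  push_cast
  rw [show ((energy m ξ : ℂ)⁻¹ * (energy m ξ : ℂ)⁻¹ * (energy m ξ : ℂ) ^ 2) = 1 by field_simp,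
    one_smul]

/-! ### The unitary phase group on the frequency side: strong continuity and time integrals. -/

theorem phaseSymbol_zero (m : ℝ) : phaseSymbol m 0 = 1 := by
  ext1 ξ
  ext1 v
  simp [phaseSymbol, scalarSymbol_apply]

theorem norm_multiplier_phaseSymbol (m t : ℝ) (f : L2) :
    ‖multiplier (phaseSymbol m t) f‖ = ‖f‖ := by
  rw [Lp.norm_def, Lp.norm_def]
  congr 1
  apply eLpNorm_congr_norm_ae
  filter_upwards [coeFn_multiplier (phaseSymbol m t) f] with x h
  rw [h, phaseSymbol, scalarSymbol_apply, norm_smul, ← Complex.ofReal_neg,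
    Complex.norm_exp_ofReal_mul_I, one_mul]

theorem integrable_inner (f g : L2) : Integrable (fun x ↦ ⟪f x, g x⟫_ℂ) :=
  L2.integrable_inner f g

theorem inner_multiplier_phaseSymbol (m t : ℝ) (g f : L2) :
    ⟪g, multiplier (phaseSymbol m t) f⟫_ℂ
      = ∫ ξ, Complex.exp (-(t * energy m ξ : ℝ) * Complex.I) * ⟪g ξ, f ξ⟫_ℂ := by
  rw [L2.inner_def]
  apply integral_congr_ae
  filter_upwards [coeFn_multiplier (phaseSymbol m t) f] with x h
  rw [h, phaseSymbol, scalarSymbol_apply, inner_smul_right]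

theorem continuous_inner_multiplier_phaseSymbol (m : ℝ) (g f : L2) :
    Continuous fun t ↦ ⟪g, multiplier (phaseSymbol m t) f⟫_ℂ := by
  simp_rw [inner_multiplier_phaseSymbol]
  apply continuous_of_dominated (bound := fun ξ ↦ ‖⟪g ξ, f ξ⟫_ℂ‖)
  · intro t
    exact (Continuous.aestronglyMeasurable (by fun_prop)).mul (integrable_inner g f).1
  · intro t
    filter_upwards with ξ
    rw [norm_mul, ← Complex.ofReal_neg, Complex.norm_exp_ofReal_mul_I, one_mul]
  · exact (integrable_inner g f).norm
  · filter_upwards with ξ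
    fun_prop

/-- Weak continuity follows from dominated convergence; since the norm is conserved, it upgrades to
norm continuity by expanding `‖a - b‖²`. -/
theorem continuous_multiplier_phaseSymbol (m : ℝ) (f : L2) :
    Continuous fun t ↦ multiplier (phaseSymbol m t) f := by
  rw [continuous_iff_continuousAt]
  intro t₀
  rw [ContinuousAt, tendsto_iff_norm_sub_tendsto_zero]
  have h (t : ℝ) : ‖multiplier (phaseSymbol m t) f - multiplier (phaseSymbol m t₀) f‖
      = √(2 * ‖f‖ ^ 2 - 2 * (⟪multiplier (phaseSymbol m t₀) f,
          multiplier (phaseSymbol m t) f⟫_ℂ).re) := by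
    rw [← Real.sqrt_sq (norm_nonneg (_ - _)), norm_sub_sq (𝕜 := ℂ), norm_multiplier_phaseSymbol,
      norm_multiplier_phaseSymbol, inner_re_symm]
    congr 1
    simp only [RCLike.re_to_complex]
    ring
  simp_rw [h]
  have hc : Continuous fun t ↦ √(2 * ‖f‖ ^ 2 - 2 * (⟪multiplier (phaseSymbol m t₀) f,
          multiplier (phaseSymbol m t) f⟫_ℂ).re) := by
    have := continuous_inner_multiplier_phaseSymbol m (multiplier (phaseSymbol m t₀) f) f
    exact (continuous_const.sub (continuous_const.mul (Complex.continuous_re.comp this))).sqrt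
  have := hc.tendsto t₀
  rwa [← h t₀, sub_self, norm_zero] at this

theorem integral_phase {m : ℝ} (hm : 0 < m) {σ : ℝ} (hσ : σ * σ = 1) (t : ℝ) (ξ : Space) :
    ∫ τ in (0 : ℝ)..t, Complex.exp (-((σ * τ : ℝ) * energy m ξ : ℝ) * Complex.I)
      = (Complex.I * σ) * ((energy m ξ : ℂ)⁻¹ *
        (Complex.exp (-((σ * t : ℝ) * energy m ξ : ℝ) * Complex.I) - 1)) := by
  have hω : (energy m ξ : ℂ) ≠ 0 := by exact_mod_cast (energy_pos hm ξ).ne'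
  have hσ' : (σ : ℂ) * σ = 1 := by exact_mod_cast hσ
  have hσ0 : (σ : ℂ) ≠ 0 := left_ne_zero_of_mul_eq_one hσ'
  have hc : -(Complex.I * σ * energy m ξ) ≠ 0 :=
    neg_ne_zero.mpr (mul_ne_zero (mul_ne_zero Complex.I_ne_zero hσ0) hω)
  have h (τ : ℝ) : -((σ * τ * energy m ξ : ℝ) : ℂ) * Complex.I
      = -(Complex.I * σ * energy m ξ) * τ := by
    push_cast
    ring
  simp_rw [h]
  rw [integral_exp_mul_complex hc, div_eq_iff hc]
  simp only [Complex.ofReal_zero, mul_zero, Complex.exp_zero]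
  linear_combination (norm := (field_simp; ring_nf))
    (-(Complex.exp (-(Complex.I * σ * energy m ξ) * t) - 1)) * hσ'
  rw [Complex.I_sq]
  ring

/-- Pairing with an arbitrary `g` replaces the `L²`-valued integral by a scalar one; Fubini then
leaves an elementary integral of an exponential at each frequency. Since `σ = ±1`, the factor
`1/(-iσ)` equals `iσ`. -/
theorem integral_multiplier_phaseSymbol {m : ℝ} (hm : 0 < m) {σ : ℝ} (hσ : σ * σ = 1) (t : ℝ)
    (f : L2) :
    ∫ τ in (0 : ℝ)..t, multiplier (phaseSymbol m (σ * τ)) f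
      = (Complex.I * σ) • multiplier (invEnergySymbol m hm)
          (multiplier (phaseSymbol m (σ * t)) f - f) := by
  refine ext_inner_left ℂ fun g ↦ ?_
  have hcont : Continuous fun τ ↦ multiplier (phaseSymbol m (σ * τ)) f :=
    (continuous_multiplier_phaseSymbol m f).comp (by fun_prop)
  have h1 : ⟪g, ∫ τ in (0 : ℝ)..t, multiplier (phaseSymbol m (σ * τ)) f⟫_ℂ
      = ∫ τ in (0 : ℝ)..t, ⟪g, multiplier (phaseSymbol m (σ * τ)) f⟫_ℂ :=
    ((innerSL ℂ g).intervalIntegral_comp_comm (hcont.intervalIntegrable 0 t)).symm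
  rw [h1]
  simp_rw [inner_multiplier_phaseSymbol]
  rw [intervalIntegral_integral_swap]
  · simp_rw [intervalIntegral.integral_mul_const, integral_phase hm hσ]
    rw [L2.inner_def]
    apply integral_congr_ae
    filter_upwards [Lp.coeFn_smul (Complex.I * σ) (multiplier (invEnergySymbol m hm)
      (multiplier (phaseSymbol m (σ * t)) f - f)),
      coeFn_multiplier (invEnergySymbol m hm) (multiplier (phaseSymbol m (σ * t)) f - f),
      Lp.coeFn_sub (multiplier (phaseSymbol m (σ * t)) f) f,
      coeFn_multiplier (phaseSymbol m (σ * t)) f] with ξ h1 h2 h3 h4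
    rw [h1, Pi.smul_apply, h2, h3, Pi.sub_apply, h4, invEnergySymbol, phaseSymbol,
      scalarSymbol_apply, scalarSymbol_apply, inner_smul_right, inner_smul_right, inner_sub_right,
      inner_smul_right]
    ring
  · have hint : Integrable (fun p : ℝ × Space ↦ ⟪g p.2, f p.2⟫_ℂ)
        ((volume.restrict (Set.uIoc 0 t)).prod volume) := by
      have : IsFiniteMeasure (volume.restrict (Set.uIoc 0 t)) := by
        rw [Set.uIoc]
        infer_instance
      exact (integrable_inner g f).comp_snd _
    refine hint.bdd_mul (c := 1) (Continuous.aestronglyMeasurable ?_) ?_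
    · fun_prop
    · filter_upwards with p
      rw [← Complex.ofReal_neg, Complex.norm_exp_ofReal_mul_I]

/-! ### The Fourier transform of the Dirac operator -/

theorem locallyIntegrable_coeFn (f : L2) : LocallyIntegrable f volume :=
  (Lp.memLp f).locallyIntegrable one_le_two

theorem smulLeftCLM_eq_of_ae_eq {g : Space → ℂ} (hg : g.HasTemperateGrowth) {h h' : L2}
    (H : h' =ᵐ[volume] fun x ↦ g x • h x) :
    smulLeftCLM Spinor g (h : 𝓢'(Space, Spinor)) = (h' : 𝓢'(Space, Spinor)) := by
  ext1 u
  simp only [Lp.toTemperedDistribution_apply, smulLeftCLM_apply_apply]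
  apply integral_congr_ae
  filter_upwards [H] with x hx
  rw [hx, SchwartzMap.smulLeftCLM_apply_apply hg, smul_smul, smul_eq_mul, mul_comm]

/-- The product `g h` need not be known to lie in `L²`; local integrability suffices, because smooth
compactly supported functions already separate locally integrable functions. -/
theorem ae_eq_of_smulLeftCLM_eq {g : Space → ℂ} (hg : g.HasTemperateGrowth) {h h' : L2}
    (H : smulLeftCLM Spinor g (h : 𝓢'(Space, Spinor)) = (h' : 𝓢'(Space, Spinor))) :
    h' =ᵐ[volume] fun x ↦ g x • h x := by
  apply ae_eq_of_integral_contDiff_smul_eq (locallyIntegrable_coeFn h')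
    ((locallyIntegrable_coeFn h).continuous_smul hg.1.continuous)
  intro u u_smooth u_cpt
  have hu₁ : HasCompactSupport (Complex.ofRealCLM ∘ u) := u_cpt.comp_left rfl
  have hu₂ : ContDiff ℝ ((⊤ : ℕ∞) : WithTop ℕ∞) (Complex.ofRealCLM ∘ u) := by fun_prop
  have := DFunLike.congr_fun H (hu₁.toSchwartzMap hu₂)
  simp only [Lp.toTemperedDistribution_apply, smulLeftCLM_apply_apply] at this
  calc
    _ = ∫ x, (hu₁.toSchwartzMap hu₂) x • h' x := by simp
    _ = _ := this.symm
    _ = _ := by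
      apply integral_congr_ae
      filter_upwards with x
      rw [SchwartzMap.smulLeftCLM_apply_apply hg]
      change (g x * (u x : ℂ)) • h x = u x • g x • h x
      rw [mul_comm, mul_smul, Complex.coe_smul]

/-- A constant matrix passes through the Fourier integral of a Schwartz function; density and
continuity extend this to `L²`. -/
theorem fourier_compLpL (L : Spinor →L[ℂ] Spinor) (f : L2) :
    𝓕 (L.compLpL 2 (volume : Measure Space) f) = L.compLpL 2 (volume : Measure Space) (𝓕 f) := by
  refine DenseRange.induction_on
    (p := fun f : L2 ↦ 𝓕 (L.compLpL 2 (volume : Measure Space) f)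
      = L.compLpL 2 (volume : Measure Space) (𝓕 f))
    (SchwartzMap.denseRange_toLpCLM (p := 2) (μ := (volume : Measure Space))
      ENNReal.ofNat_ne_top) f ?_ ?_
  · have h : Continuous fun f : L2 ↦ 𝓕 f := (Lp.fourierTransformₗᵢ Space Spinor).continuous
    exact isClosed_eq (h.comp (L.compLpL 2 _).continuous) ((L.compLpL 2 _).continuous.comp h)
  · intro f
    have h1 (f : 𝓢(Space, Spinor)) : L.compLpL 2 (volume : Measure Space) (f.toLp 2)
        = (SchwartzMap.postcompCLM L f).toLp 2 := by
      apply Lp.ext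
      filter_upwards [L.coeFn_compLpL (f.toLp 2), f.coeFn_toLp 2 volume,
        (SchwartzMap.postcompCLM L f).coeFn_toLp 2 volume] with x h1 h2 h3
      rw [h1, h2, h3, SchwartzMap.postcompCLM_apply]
    have h2 : 𝓕 (SchwartzMap.postcompCLM L f) = SchwartzMap.postcompCLM L (𝓕 f) := by
      ext1 x
      rw [SchwartzMap.postcompCLM_apply, SchwartzMap.fourier_coe, SchwartzMap.fourier_coe,
        Real.fourier_eq, Real.fourier_eq, ← L.integral_comp_comm]
      · simp only [SchwartzMap.postcompCLM_apply, Circle.smul_def, map_smul]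
      · exact (Real.fourierIntegral_convergent_iff x).mpr f.integrable
    simp only [SchwartzMap.toLpCLM_apply]
    rw [h1, SchwartzMap.toLp_fourier_eq, SchwartzMap.toLp_fourier_eq, h1, h2]

theorem fourier_weakDeriv (j : Fin 3) (f : sobolevH1) :
    (𝓕 (weakDeriv j f) : L2)
      =ᵐ[volume] fun ξ ↦ (2 * Real.pi * Complex.I * ξ j) • (𝓕 (f : L2) : L2) ξ := by
  set e : Space := EuclideanSpace.single j (1 : ℝ)
  have h : ((𝓕 (weakDeriv j f) : L2) : 𝓢'(Space, Spinor)) = (2 * Real.pi * Complex.I) •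
      smulLeftCLM Spinor (fun ξ : Space ↦ ((inner ℝ ξ e : ℝ) : ℂ))
        ((𝓕 (f : L2) : L2) : 𝓢'(Space, Spinor)) := by
    rw [← Lp.fourier_toTemperedDistribution_eq, ← Lp.fourier_toTemperedDistribution_eq,
      ← fourier_lineDerivOp_eq]
    exact congrArg _ (weakDerivFun_spec j f)
  have hg : (fun ξ : Space ↦ ((inner ℝ ξ e : ℝ) : ℂ)).HasTemperateGrowth := by fun_prop
  rw [← smul_apply, ← smulLeftCLM_smul hg] at h
  filter_upwards [ae_eq_of_smulLeftCLM_eq (by fun_prop) h.symm] with ξ hξ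
  rw [hξ]
  simp [e, EuclideanSpace.inner_single_right]

theorem fourier_diracOperator (m : ℝ) (f : sobolevH1) :
    (𝓕 (diracOperator m f) : L2)
      =ᵐ[volume] fun ξ ↦ diracSymbol m ξ ((𝓕 (f : L2) : L2) ξ) := by
  have hadd (f g : L2) : 𝓕 (f + g) = 𝓕 f + 𝓕 g := (Lp.fourierTransformₗᵢ Space Spinor).map_add f g
  have hsmul (c : ℂ) (f : L2) : 𝓕 (c • f) = c • 𝓕 f :=
    (Lp.fourierTransformₗᵢ Space Spinor).map_smul c f
  rw [diracOperator_apply, Fin.sum_univ_three, hadd, hadd, hadd]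
  simp only [hsmul]
  have hmat (A : Matrix (Fin 4) (Fin 4) ℂ) (f : L2) : (𝓕 (matrixAct A f) : L2)
      =ᵐ[volume] fun ξ ↦ Matrix.toEuclideanCLM (𝕜 := ℂ) A ((𝓕 f : L2) ξ) := by
    rw [matrixAct, fourier_compLpL]
    exact ContinuousLinearMap.coeFn_compLpL _ _
  have hterm (c : ℂ) (A : Matrix (Fin 4) (Fin 4) ℂ) (f : L2) :
      (c • 𝓕 (matrixAct A f) : L2)
      =ᵐ[volume] fun ξ ↦ c • Matrix.toEuclideanCLM (𝕜 := ℂ) A ((𝓕 f : L2) ξ) := by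
    filter_upwards [Lp.coeFn_smul c (𝓕 (matrixAct A f)), hmat A f] with ξ h1 h2
    rw [h1, Pi.smul_apply, h2]
  filter_upwards [Lp.coeFn_add ((1 / Complex.I) • 𝓕 (matrixAct (alpha 0) (weakDeriv 0 f))
      + (1 / Complex.I) • 𝓕 (matrixAct (alpha 1) (weakDeriv 1 f))
      + (1 / Complex.I) • 𝓕 (matrixAct (alpha 2) (weakDeriv 2 f)))
      ((m : ℂ) • 𝓕 (matrixAct beta (f : L2))),
    Lp.coeFn_add ((1 / Complex.I) • 𝓕 (matrixAct (alpha 0) (weakDeriv 0 f))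
      + (1 / Complex.I) • 𝓕 (matrixAct (alpha 1) (weakDeriv 1 f)))
      ((1 / Complex.I) • 𝓕 (matrixAct (alpha 2) (weakDeriv 2 f))),
    Lp.coeFn_add ((1 / Complex.I) • 𝓕 (matrixAct (alpha 0) (weakDeriv 0 f)))
      ((1 / Complex.I) • 𝓕 (matrixAct (alpha 1) (weakDeriv 1 f))),
    hterm (1 / Complex.I) (alpha 0) (weakDeriv 0 f), hterm (1 / Complex.I) (alpha 1) (weakDeriv 1 f),
    hterm (1 / Complex.I) (alpha 2) (weakDeriv 2 f), hterm m beta (f : L2),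
    fourier_weakDeriv 0 f, fourier_weakDeriv 1 f, fourier_weakDeriv 2 f]
    with ξ h1 h2 h3 h4 h5 h6 h7 h8 h9 h10
  rw [h1, Pi.add_apply, h2, Pi.add_apply, h3, Pi.add_apply, h4, h5, h6, h7, h8, h9, h10]
  simp only [diracSymbol, Fin.sum_univ_three, add_apply,
    smul_apply, map_smul, smul_smul]
  have (j : Fin 3) : 1 / Complex.I * (2 * Real.pi * Complex.I * ξ j)
      = ((2 * Real.pi * ξ j : ℝ) : ℂ) := by
    push_cast
    field_simp
  rw [this, this, this]

/-! ### The inverse of the Dirac operator -/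

/-- The inverse of the free Dirac operator. -/
def diracInverse (m : ℝ) (hm : 0 < m) (g : L2) : L2 :=
  𝓕⁻ (multiplier (invEnergySymbol m hm) (multiplier (signSymbol m hm) (𝓕 g)))

theorem fourier_diracInverse {m : ℝ} (hm : 0 < m) (g : L2) :
    (𝓕 (diracInverse m hm g) : L2) =ᵐ[volume] fun ξ ↦
      ((energy m ξ : ℂ)⁻¹ * (energy m ξ : ℂ)⁻¹) • diracSymbol m ξ ((𝓕 g : L2) ξ) := by
  rw [diracInverse, FourierTransform.fourier_fourierInv_eq]
  filter_upwards [coeFn_multiplier (invEnergySymbol m hm) (multiplier (signSymbol m hm) (𝓕 g)),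
    coeFn_multiplier (signSymbol m hm) (𝓕 g)] with ξ h1 h2
  rw [h1, h2, invEnergySymbol, scalarSymbol_apply, mul_smul]
  rfl

theorem diracSymbol_diracSymbol_apply {m : ℝ} (hm : 0 < m) (ξ : Space) (v : Spinor) :
    ((energy m ξ : ℂ)⁻¹ * (energy m ξ : ℂ)⁻¹) • diracSymbol m ξ (diracSymbol m ξ v) = v := by
  have : (energy m ξ : ℂ) ≠ 0 := by exact_mod_cast (energy_pos hm ξ).ne'
  rw [← mul_apply_eq_comp, diracSymbol_mul_self, smul_apply, smul_smul]
  push_cast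
  rw [show ((energy m ξ : ℂ)⁻¹ * (energy m ξ : ℂ)⁻¹ * (energy m ξ : ℂ) ^ 2) = 1 by field_simp,
    one_smul]
  rfl

theorem diracInverse_diracOperator {m : ℝ} (hm : 0 < m) (f : sobolevH1) :
    diracInverse m hm (diracOperator m f) = f := by
  apply (Lp.fourierTransformₗᵢ Space Spinor).injective
  apply Lp.ext
  filter_upwards [fourier_diracInverse hm (diracOperator m f), fourier_diracOperator m f]
    with ξ h1 h2
  refine h1.trans ?_
  rw [h2, diracSymbol_diracSymbol_apply hm]
  rfl

theorem diracInverse_mem {m : ℝ} (hm : 0 < m) (g : L2) : diracInverse m hm g ∈ sobolevH1 := by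
  change MemSobolev 1 2 ((diracInverse m hm g : L2) : 𝓢'(Space, Spinor))
  rw [memSobolev_iff_exists_smulLeftCLM_fourier, Lp.fourier_toTemperedDistribution_eq]
  have hne (ξ : Space) : (energy m ξ : ℂ) ≠ 0 := by exact_mod_cast (energy_pos hm ξ).ne'
  -- `S` is the `H¹` weight divided by the energy. From `1 ≤ E/m` and `|ξ| ≤ E`, the numerator is at
  -- most `1 + |ξ| ≤ (m⁻¹ + 1)E`, so `S` is bounded.
  let S : Symbol := scalarSymbol
    (fun ξ ↦ (((1 + ‖ξ‖ ^ 2) ^ ((1 : ℝ) / 2) : ℝ) : ℂ) * (energy m ξ : ℂ)⁻¹)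
    (by
      have h : (0 : ℝ) ≤ 1 / 2 := by norm_num
      fun_prop (disch := assumption)) (m⁻¹ + 1) (by
      intro ξ
      have h := energy_pos hm ξ
      have h1 : (1 + ‖ξ‖ ^ 2) ^ ((1 : ℝ) / 2) ≤ 1 + ‖ξ‖ := by
        rw [← Real.sqrt_eq_rpow]
        exact Real.sqrt_le_iff.mpr ⟨by positivity, by nlinarith [norm_nonneg ξ]⟩
      rw [norm_mul, norm_inv, Complex.norm_real, Complex.norm_real, Real.norm_of_nonneg h.le,
        Real.norm_of_nonneg (by positivity), ← div_eq_mul_inv, div_le_iff₀ h]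
      have h2 : 1 ≤ m⁻¹ * energy m ξ := by
        rw [inv_mul_eq_div, one_le_div hm]
        exact le_energy ξ
      linarith [norm_le_energy m ξ])
  refine ⟨multiplier S (multiplier (signSymbol m hm) (𝓕 g)), ?_⟩
  apply smulLeftCLM_eq_of_ae_eq (by fun_prop)
  filter_upwards [coeFn_multiplier S (multiplier (signSymbol m hm) (𝓕 g)),
    coeFn_multiplier (signSymbol m hm) (𝓕 g), fourier_diracInverse hm g] with ξ h1 h2 h3
  rw [h1, h2, h3, scalarSymbol_apply, mul_smul, mul_smul]
  rfl

theorem diracOperator_diracInverse {m : ℝ} (hm : 0 < m) (g : L2) :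
    diracOperator m ⟨diracInverse m hm g, diracInverse_mem hm g⟩ = g := by
  apply (Lp.fourierTransformₗᵢ Space Spinor).injective
  apply Lp.ext
  filter_upwards [fourier_diracInverse hm g,
    fourier_diracOperator m ⟨diracInverse m hm g, diracInverse_mem hm g⟩] with ξ h1 h2
  refine h2.trans ?_
  rw [h1, map_smul, diracSymbol_diracSymbol_apply hm]
  rfl

/-- The inverse of the free Dirac operator as a bounded operator. -/
def diracInverseCLM (m : ℝ) (hm : 0 < m) : L2 →L[ℂ] L2 :=
  (Lp.fourierTransformₗᵢ Space Spinor).symm.toContinuousLinearEquiv.toContinuousLinearMap ∘L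
    multiplier (invEnergySymbol m hm) ∘L multiplier (signSymbol m hm) ∘L
    (Lp.fourierTransformₗᵢ Space Spinor).toContinuousLinearEquiv.toContinuousLinearMap

theorem diracInverseCLM_apply {m : ℝ} (hm : 0 < m) (g : L2) :
    diracInverseCLM m hm g = diracInverse m hm g := rfl

theorem inner_diracInverse {m : ℝ} (hm : 0 < m) (f g : L2) :
    ⟪diracInverse m hm f, g⟫_ℂ = ⟪f, diracInverse m hm g⟫_ℂ := by
  rw [← Lp.inner_fourier_eq, ← Lp.inner_fourier_eq f, L2.inner_def, L2.inner_def]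
  apply integral_congr_ae
  filter_upwards [fourier_diracInverse hm f, fourier_diracInverse hm g] with ξ h1 h2
  rw [h1, h2, inner_smul_left, inner_smul_right, inner_diracSymbol]
  simp

/-! ### Well-posedness -/

/-- This trades the unbounded operator and its domain condition for a bounded inverse, whose range
lies in `H¹` automatically. -/
theorem isDiracSolution_iff {m : ℝ} (hm : 0 < m) (u₀ : L2) (u : ℝ → L2) :
    IsDiracSolution m u₀ u ↔ Continuous u ∧ u 0 = u₀ ∧
      ∀ t, ∫ τ in (0 : ℝ)..t, u τ = diracInverseCLM m hm (Complex.I • (u t - u₀)) := by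
  constructor
  · intro h
    refine ⟨h.continuous, h.initial, fun t ↦ ?_⟩
    obtain ⟨h1, h2⟩ := h.equation t
    rw [h2, diracInverseCLM_apply]
    exact (diracInverse_diracOperator hm ⟨_, h1⟩).symm
  · rintro ⟨h1, h2, h3⟩
    refine ⟨h1, h2, fun t ↦ ?_⟩
    have h4 : ∫ τ in (0 : ℝ)..t, u τ = diracInverse m hm (Complex.I • (u t - u₀)) := h3 t
    refine ⟨h4 ▸ diracInverse_mem hm _, ?_⟩
    exact (diracOperator_diracInverse hm _).symm.trans (congrArg _ (Subtype.ext h4.symm))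

theorem diracInverse_eq_zero {m : ℝ} (hm : 0 < m) {f : L2} (h : diracInverseCLM m hm f = 0) :
    f = 0 := by
  have h1 := diracOperator_diracInverse hm f
  have h2 : (⟨diracInverse m hm f, diracInverse_mem hm f⟩ : sobolevH1) = 0 := Subtype.ext h
  rw [← h1]
  exact (congrArg (diracOperator m) h2).trans (diracOperator m).map_zero

theorem isDiracSolution_unique {m : ℝ} (hm : 0 < m) {u₀ : L2} {u v : ℝ → L2}
    (hu : IsDiracSolution m u₀ u) (hv : IsDiracSolution m u₀ v) : u = v := by
  rw [isDiracSolution_iff hm] at hu hv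
  obtain ⟨hu1, hu2, hu3⟩ := hu
  obtain ⟨hv1, hv2, hv3⟩ := hv
  set B := diracInverseCLM m hm
  let W : ℝ → L2 := fun t ↦ ∫ τ in (0 : ℝ)..t, (u τ - v τ)
  have hw : Continuous fun t ↦ u t - v t := hu1.sub hv1
  have hW (t : ℝ) : HasDerivAt W (u t - v t) t :=
    intervalIntegral.integral_hasDerivAt_right (hw.intervalIntegrable _ _)
      (hw.stronglyMeasurableAtFilter _ _) hw.continuousAt
  have hBw (t : ℝ) : B (u t - v t) = -Complex.I • W t := by
    have : W t = Complex.I • B (u t - v t) := by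
      change ∫ τ in (0 : ℝ)..t, (u τ - v τ) = _
      rw [intervalIntegral.integral_sub (hu1.intervalIntegrable _ _) (hv1.intervalIntegrable _ _),
        hu3, hv3, ← map_sub, ← map_smul]
      congr 1
      module
    rw [this, smul_smul]
    simp
  have hBW (t : ℝ) : HasDerivAt (fun t ↦ B (W t)) (B (u t - v t)) t :=
    ((B.restrictScalars ℝ).hasFDerivAt.comp_hasDerivAt t (hW t))
  have hsymm (f g : L2) : ⟪B f, g⟫_ℂ = ⟪f, B g⟫_ℂ := inner_diracInverse hm f g
  -- The derivative is `⟪BW, -iW⟫ + ⟪-iW, BW⟫`, which vanishes by the symmetry of `B`.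
  have hE (t : ℝ) : HasDerivAt (fun t ↦ ⟪B (W t), B (W t)⟫_ℂ) 0 t := by
    refine ((hBW t).inner ℂ (hBW t)).congr_deriv ?_
    rw [hBw, inner_smul_left, inner_smul_right, hsymm]
    simp
  have hB0 (t : ℝ) : B (W t) = 0 := by
    have hconst := is_const_of_deriv_eq_zero (fun t ↦ (hE t).differentiableAt)
      (fun t ↦ (hE t).deriv) t 0
    have hW0 : W 0 = 0 := intervalIntegral.integral_same
    rw [hW0, map_zero, inner_zero_left] at hconst
    exact inner_self_eq_zero.mp hconst
  have hW0 : W = fun _ ↦ 0 := funext fun t ↦ diracInverse_eq_zero hm (hB0 t)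
  funext t
  have h1 := hW t
  rw [hW0] at h1
  exact sub_eq_zero.mp (h1.unique (hasDerivAt_const t 0))

/-! ### Existence by splitting into positive and negative energies. -/

/-- The projection onto the positive (`σ = 1`) or negative (`σ = -1`) energy states. -/
def energyProjection (m : ℝ) (hm : 0 < m) (σ : ℝ) : Symbol :=
  (1 / 2 : ℂ) • (1 + (σ : ℂ) • signSymbol m hm)

theorem signSymbol_mul_energyProjection {m : ℝ} (hm : 0 < m) {σ : ℝ} (hσ : σ * σ = 1) :
    signSymbol m hm * energyProjection m hm σ = (σ : ℂ) • energyProjection m hm σ := by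
  have hσ' : (σ : ℂ) * σ = 1 := by exact_mod_cast hσ
  have h := signSymbol_mul_self hm
  ext1 ξ
  have hξ : signSymbol m hm ξ * signSymbol m hm ξ = 1 := DFunLike.congr_fun h ξ
  change signSymbol m hm ξ * ((1 / 2 : ℂ) • (1 + (σ : ℂ) • signSymbol m hm ξ))
    = (σ : ℂ) • (1 / 2 : ℂ) • (1 + (σ : ℂ) • signSymbol m hm ξ)
  rw [mul_smul_comm, mul_add, mul_smul_comm, hξ, mul_one, smul_comm (σ : ℂ) (1 / 2 : ℂ),
    smul_add (σ : ℂ), smul_smul (σ : ℂ), hσ', one_smul, add_comm]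

theorem energyProjection_add {m : ℝ} (hm : 0 < m) :
    energyProjection m hm 1 + energyProjection m hm (-1) = 1 := by
  rw [energyProjection, energyProjection]
  push_cast
  module

theorem norm_energyProjection_apply_le {m : ℝ} (hm : 0 < m) {σ : ℝ} (hσ : σ * σ = 1) (f : L2) :
    ‖multiplier (energyProjection m hm σ) f‖ ≤ ‖f‖ := by
  have h1 : ‖(σ : ℂ)‖ = 1 := by
    rw [Complex.norm_real, Real.norm_eq_abs]
    exact (mul_self_eq_one_iff.mp hσ).elim (fun h ↦ by simp [h]) (fun h ↦ by simp [h])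
  refine (norm_multiplier_apply_le _ (C := 1) (fun x ↦ ?_) f).trans_eq (one_mul _)
  change ‖(1 / 2 : ℂ) • ((1 : Spinor →L[ℂ] Spinor) + (σ : ℂ) • signSymbol m hm x)‖ ≤ 1
  have h2 : ‖signSymbol m hm x‖ ≤ 1 :=
    (BoundedContinuousFunction.norm_coe_le_norm _ x).trans
      (BoundedContinuousFunction.norm_ofNormedAddCommGroup_le _ zero_le_one _)
  have h3 : ‖(1 : Spinor →L[ℂ] Spinor) + (σ : ℂ) • signSymbol m hm x‖ ≤ 1 + 1 := by
    refine (norm_add_le _ _).trans (add_le_add norm_one.le ?_)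
    rwa [norm_smul, h1, one_mul]
  rw [norm_smul]
  norm_num
  linarith

/-- The part of `exp (-i t H_m) f` in the positive or negative energy states. -/
def evolutionPart (m : ℝ) (hm : 0 < m) (σ t : ℝ) (f : L2) : L2 :=
  𝓕⁻ (multiplier (phaseSymbol m (σ * t)) (multiplier (energyProjection m hm σ) (𝓕 f)))

theorem continuous_evolutionPart {m : ℝ} (hm : 0 < m) (σ : ℝ) (f : L2) :
    Continuous fun t ↦ evolutionPart m hm σ t f :=
  (Lp.fourierTransformₗᵢ Space Spinor).symm.continuous.comp
    ((continuous_multiplier_phaseSymbol m _).comp (continuous_const.mul continuous_id))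

theorem phaseSymbol_mul_comm (m t : ℝ) (A : Symbol) :
    A * phaseSymbol m t = phaseSymbol m t * A := by
  ext1 ξ
  ext1 v
  exact map_smul (A ξ) _ v

/-- On the range of the projection the sign of the Dirac operator acts as `σ`, so its inverse has
symbol `σ/E`. This is, up to the factor `i`, what the time integral of the phase produces. -/
theorem integral_evolutionPart {m : ℝ} (hm : 0 < m) {σ : ℝ} (hσ : σ * σ = 1) (t : ℝ) (f : L2) :
    ∫ τ in (0 : ℝ)..t, evolutionPart m hm σ τ f
      = diracInverseCLM m hm
        (Complex.I • (evolutionPart m hm σ t f - evolutionPart m hm σ 0 f)) := by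
  set F : L2 →L[ℂ] L2 :=
    (Lp.fourierTransformₗᵢ Space Spinor).toContinuousLinearEquiv.toContinuousLinearMap
  set G : L2 →L[ℂ] L2 :=
    (Lp.fourierTransformₗᵢ Space Spinor).symm.toContinuousLinearEquiv.toContinuousLinearMap
  set g := multiplier (energyProjection m hm σ) (𝓕 f) with hg
  have hcont : Continuous fun τ ↦ multiplier (phaseSymbol m (σ * τ)) g :=
    (continuous_multiplier_phaseSymbol m g).comp (by fun_prop)
  have h1 : ∫ τ in (0 : ℝ)..t, evolutionPart m hm σ τ f
      = G (∫ τ in (0 : ℝ)..t, multiplier (phaseSymbol m (σ * τ)) g) :=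
    G.intervalIntegral_comp_comm (hcont.intervalIntegrable 0 t)
  have hsign : multiplier (signSymbol m hm) g = (σ : ℂ) • g := by
    rw [hg, ← multiplier_mul, signSymbol_mul_energyProjection hm hσ, multiplier_smul]
  have hFG (h : L2) : F (G h) = h := (Lp.fourierTransformₗᵢ Space Spinor).apply_symm_apply h
  have h2 (t : ℝ) : evolutionPart m hm σ t f = G (multiplier (phaseSymbol m (σ * t)) g) := rfl
  have h3 (h : L2) : diracInverseCLM m hm h
      = G (multiplier (invEnergySymbol m hm) (multiplier (signSymbol m hm) (F h))) := rfl
  rw [h1, integral_multiplier_phaseSymbol hm hσ, h3, h2, h2, ← map_sub, map_smul F, hFG,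
    mul_zero, phaseSymbol_zero, multiplier_one]
  congr 1
  rw [map_smul, map_smul, map_sub (multiplier (signSymbol m hm)), ← multiplier_mul (signSymbol m hm),
    phaseSymbol_mul_comm, multiplier_mul, hsign, map_smul, ← smul_sub, map_smul, smul_smul]

theorem isDiracSolution_evolution {m : ℝ} (hm : 0 < m) (u₀ : L2) :
    IsDiracSolution m u₀ fun t ↦ evolutionPart m hm 1 t u₀ + evolutionPart m hm (-1) t u₀ := by
  have h0 : evolutionPart m hm 1 0 u₀ + evolutionPart m hm (-1) 0 u₀ = u₀ := by
    rw [evolutionPart, evolutionPart, mul_zero, mul_zero, phaseSymbol_zero, multiplier_one,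
      multiplier_one]
    refine ((Lp.fourierTransformₗᵢ Space Spinor).symm.map_add _ _).symm.trans ?_
    rw [← multiplier_add, energyProjection_add, multiplier_one]
    exact (Lp.fourierTransformₗᵢ Space Spinor).symm_apply_apply u₀
  rw [isDiracSolution_iff hm]
  refine ⟨(continuous_evolutionPart hm 1 u₀).add (continuous_evolutionPart hm (-1) u₀), h0,
    fun t ↦ ?_⟩
  rw [intervalIntegral.integral_add ((continuous_evolutionPart hm 1 u₀).intervalIntegrable _ _)
    ((continuous_evolutionPart hm (-1) u₀).intervalIntegrable _ _),
    integral_evolutionPart hm (by norm_num), integral_evolutionPart hm (by norm_num), ← map_add,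
    ← smul_add]
  have (a b c d e : L2) (h : b + d = e) : a - b + (c - d) = a + c - e := by
    rw [← h]
    abel
  rw [this _ _ _ _ _ h0]

/-! ### A `TT*` estimate -/

theorem two_mul_enorm_mul_enorm_le (z w : ℂ) : 2 * (‖z‖ₑ * ‖w‖ₑ) ≤ ‖z‖ₑ ^ 2 + ‖w‖ₑ ^ 2 := by
  simp only [enorm_eq_nnnorm]
  rw [← mul_assoc]
  exact_mod_cast two_mul_le_add_sq ‖z‖₊ ‖w‖₊

section Schur

variable {X Y : Type*} [MeasurableSpace X] [MeasurableSpace Y]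

/-- Schur's test for the quadratic form with a Hermitian kernel. -/
theorem lintegral_kernel_le (μ : Measure Y) [SFinite μ] (K : Y → Y → ℂ)
    (hK : Measurable (Function.uncurry K)) (hsymm : ∀ y z, ‖K y z‖ₑ = ‖K z y‖ₑ) (f : Y → ℂ)
    (hf : Measurable f) (M : ℝ≥0∞) (hM : ∀ y, ∫⁻ z, ‖K y z‖ₑ ∂μ ≤ M) :
    ∫⁻ p : Y × Y, ‖f p.1‖ₑ * ‖f p.2‖ₑ * ‖K p.1 p.2‖ₑ ∂(μ.prod μ) ≤ M * ∫⁻ y, ‖f y‖ₑ ^ 2 ∂μ := by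
  have hK' : Measurable fun p : Y × Y ↦ ‖K p.1 p.2‖ₑ := hK.enorm
  have hf' : Measurable fun y ↦ ‖f y‖ₑ ^ 2 := hf.enorm.pow_const 2
  have hKy (y : Y) : Measurable fun z ↦ ‖K y z‖ₑ := hK'.comp measurable_prodMk_left
  have hm1 : Measurable fun p : Y × Y ↦ ‖f p.1‖ₑ ^ 2 * ‖K p.1 p.2‖ₑ := by fun_prop
  have hm2 : Measurable fun p : Y × Y ↦ ‖f p.2‖ₑ ^ 2 * ‖K p.1 p.2‖ₑ := by fun_prop
  have hm3 : Measurable fun p : Y × Y ↦ ‖f p.1‖ₑ * ‖f p.2‖ₑ * ‖K p.1 p.2‖ₑ := by fun_prop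
  have h1 : ∫⁻ p : Y × Y, ‖f p.1‖ₑ ^ 2 * ‖K p.1 p.2‖ₑ ∂(μ.prod μ) ≤ M * ∫⁻ y, ‖f y‖ₑ ^ 2 ∂μ := by
    rw [lintegral_prod _ hm1.aemeasurable,
      ← lintegral_const_mul _ hf']
    refine lintegral_mono fun y ↦ ?_
    change ∫⁻ z, ‖f y‖ₑ ^ 2 * ‖K y z‖ₑ ∂μ ≤ _
    rw [lintegral_const_mul _ (hKy y), mul_comm]
    exact mul_le_mul_left (hM y) _
  have h2 : ∫⁻ p : Y × Y, ‖f p.2‖ₑ ^ 2 * ‖K p.1 p.2‖ₑ ∂(μ.prod μ) ≤ M * ∫⁻ y, ‖f y‖ₑ ^ 2 ∂μ := by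
    rw [lintegral_prod_symm _ hm2.aemeasurable,
      ← lintegral_const_mul _ hf']
    refine lintegral_mono fun y ↦ ?_
    change ∫⁻ z, ‖f y‖ₑ ^ 2 * ‖K z y‖ₑ ∂μ ≤ _
    simp_rw [hsymm _ y]
    rw [lintegral_const_mul _ (hKy y), mul_comm]
    exact mul_le_mul_left (hM y) _
  -- By `2|f(y)||f(z)| ≤ |f(y)|² + |f(z)|²`, the form splits into the row bound `h1` and the column
  -- bound `h2`, the latter coming from the symmetry of `|K|`.
  have h3 : 2 * ∫⁻ p : Y × Y, ‖f p.1‖ₑ * ‖f p.2‖ₑ * ‖K p.1 p.2‖ₑ ∂(μ.prod μ)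
      ≤ 2 * (M * ∫⁻ y, ‖f y‖ₑ ^ 2 ∂μ) := by
    rw [← lintegral_const_mul _ hm3, two_mul (M * _)]
    refine le_trans ?_ (add_le_add h1 h2)
    rw [← lintegral_add_left hm1]
    refine lintegral_mono fun p ↦ ?_
    rw [← mul_assoc, ← add_mul]
    exact mul_le_mul_left (two_mul_enorm_mul_enorm_le _ _) _
  exact (ENNReal.mul_le_mul_iff_right two_ne_zero ENNReal.ofNat_ne_top).mp h3

/-- An integral operator `f ↦ ∫ φ(x, y) f(y) dy` is bounded on `L²` if the kernel of `T* T`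
satisfies Schur's condition. -/
theorem lintegral_enorm_sq_integral_le (ν : Measure X) (μ : Measure Y) [SFinite ν] [SFinite μ]
    (φ : X → Y → ℂ) (hφ : Measurable (Function.uncurry φ)) (w : X → ℝ)
    (hw : Integrable (fun x ↦ w x ^ 2) ν) (hφw : ∀ x y, ‖φ x y‖ ≤ w x) (f : Y → ℂ)
    (hf : Measurable f) (hfint : Integrable f μ) (M : ℝ≥0∞)
    (hM : ∀ y, ∫⁻ z, ‖∫ x, φ x y * conj (φ x z) ∂ν‖ₑ ∂μ ≤ M) :
    ∫⁻ x, ‖∫ y, φ x y * f y ∂μ‖ₑ ^ 2 ∂ν ≤ M * ∫⁻ y, ‖f y‖ₑ ^ 2 ∂μ := by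
  let v : X → ℂ := fun x ↦ ∫ y, φ x y * f y ∂μ
  let Φ : X → Y × Y → ℂ := fun x p ↦ (φ x p.1 * f p.1) * conj (φ x p.2 * f p.2)
  let K : Y → Y → ℂ := fun y z ↦ ∫ x, φ x y * conj (φ x z) ∂ν
  have hconj : Measurable (conj : ℂ → ℂ) := Complex.continuous_conj.measurable
  have hφ1 : Measurable fun q : X × Y × Y ↦ φ q.1 q.2.1 :=
    hφ.comp (by fun_prop : Measurable fun q : X × Y × Y ↦ (q.1, q.2.1))
  have hφ2 : Measurable fun q : X × Y × Y ↦ φ q.1 q.2.2 :=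
    hφ.comp (by fun_prop : Measurable fun q : X × Y × Y ↦ (q.1, q.2.2))
  have hΦm : Measurable (Function.uncurry Φ) :=
    (hφ1.mul (hf.comp (by fun_prop))).mul (hconj.comp (hφ2.mul (hf.comp (by fun_prop))))
  have hKm : Measurable (Function.uncurry K) := by
    have : StronglyMeasurable (Function.uncurry fun (p : Y × Y) (x : X) ↦
        φ x p.1 * conj (φ x p.2)) := by
      refine Measurable.stronglyMeasurable ?_
      exact (hφ.comp (by fun_prop : Measurable fun q : (Y × Y) × X ↦ (q.2, q.1.1))).mul
        (hconj.comp (hφ.comp (by fun_prop : Measurable fun q : (Y × Y) × X ↦ (q.2, q.1.2))))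
    exact this.integral_prod_right.measurable
  -- Fubini on `X × Y × Y` needs absolute integrability; the dominating function `w(x)²|f(y)||f(z)|`
  -- supplies it.
  have hΦint : Integrable (Function.uncurry Φ) (ν.prod (μ.prod μ)) := by
    refine (hw.mul_prod (hfint.norm.mul_prod hfint.norm)).mono' hΦm.aestronglyMeasurable ?_
    filter_upwards with q
    have h1 := hφw q.1 q.2.1
    have h2 := hφw q.1 q.2.2
    simp only [Function.uncurry, Φ, norm_mul, RCLike.norm_conj]
    have hw0 : 0 ≤ w q.1 := (norm_nonneg _).trans h1
    calc
      _ ≤ (w q.1 * ‖f q.2.1‖) * (w q.1 * ‖f q.2.2‖) := by gcongr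
      _ = _ := by ring
  have hv2 (x : X) : v x * conj (v x) = ∫ p, Φ x p ∂(μ.prod μ) := by
    simp only [v, Φ]
    rw [← integral_conj, ← integral_prod_mul (fun y ↦ φ x y * f y) (fun y ↦ conj (φ x y * f y))]
  have hvint : Integrable (fun x ↦ v x * conj (v x)) ν := by
    simp_rw [hv2]
    exact hΦint.integral_prod_left
  have hvsq (x : X) : ‖v x‖ ^ 2 = (v x * conj (v x)).re := by
    rw [Complex.mul_conj, Complex.ofReal_re, Complex.normSq_eq_norm_sq]
  calc
    _ = ENNReal.ofReal (∫ x, ‖v x‖ ^ 2 ∂ν) := by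
      rw [ofReal_integral_eq_lintegral_ofReal]
      · refine lintegral_congr fun x ↦ ?_
        rw [ENNReal.ofReal_pow (norm_nonneg _), ofReal_norm]
      · simp_rw [hvsq]
        exact hvint.re
      · exact Filter.Eventually.of_forall fun x ↦ sq_nonneg _
    _ = ENNReal.ofReal (∫ x, v x * conj (v x) ∂ν).re := by
      congr 1
      rw [← RCLike.re_to_complex, ← integral_re hvint]
      exact integral_congr_ae (Filter.Eventually.of_forall hvsq)
    _ ≤ ‖∫ x, v x * conj (v x) ∂ν‖ₑ := by
      rw [← ofReal_norm]
      exact ENNReal.ofReal_le_ofReal (Complex.re_le_norm _)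
    -- Carrying out the `x` integral first turns `∫ |v|²` into the quadratic form of `K`.
    _ = ‖∫ p : Y × Y, f p.1 * conj (f p.2) * K p.1 p.2 ∂(μ.prod μ)‖ₑ := by
      simp_rw [hv2]
      rw [integral_integral_swap hΦint]
      congr 2 with p
      simp only [Φ, K]
      rw [← integral_const_mul]
      congr 1 with x
      rw [map_mul]
      ring
    _ ≤ ∫⁻ p : Y × Y, ‖f p.1 * conj (f p.2) * K p.1 p.2‖ₑ ∂(μ.prod μ) :=
      enorm_integral_le_lintegral_enorm _
    _ = ∫⁻ p : Y × Y, ‖f p.1‖ₑ * ‖f p.2‖ₑ * ‖K p.1 p.2‖ₑ ∂(μ.prod μ) := by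
      simp [enorm_mul]
    _ ≤ _ := by
      refine lintegral_kernel_le μ K hKm (fun y z ↦ ?_) f hf M hM
      rw [← RCLike.enorm_conj (K y z)]
      simp only [K]
      rw [← integral_conj]
      simp only [map_mul, RCLike.conj_conj, mul_comm]

end Schur

/-! ### A weighted surface estimate for the level sets of the energy -/

theorem lintegral_cylindrical (F : ℝ → ℝ → ℝ≥0∞) (hF : Measurable (Function.uncurry F)) :
    ∫⁻ η : Space, F (η 0) (η 1 ^ 2 + η 2 ^ 2)
      = ∫⁻ x, ENNReal.ofReal (2 * Real.pi) *
          ∫⁻ r in Set.Ioi (0 : ℝ), ENNReal.ofReal r * F x (r ^ 2) := by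
  have h1 := EuclideanSpace.volume_preserving_symm_measurableEquiv_toLp (Fin 3)
  have h2 := volume_preserving_piFinSuccAbove (fun _ : Fin 3 ↦ ℝ) 0
  have h3 : MeasurePreserving (Prod.map id MeasurableEquiv.finTwoArrow)
      (volume.prod volume : Measure (ℝ × (Fin 2 → ℝ))) (volume.prod volume : Measure (ℝ × ℝ × ℝ)) :=
    (MeasurePreserving.id volume).prod (volume_preserving_finTwoArrow ℝ)
  have h := h3.comp (h2.comp h1)
  have hmeas : Measurable fun p : ℝ × ℝ × ℝ ↦ F p.1 (p.2.1 ^ 2 + p.2.2 ^ 2) :=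
    hF.comp (by fun_prop : Measurable fun p : ℝ × ℝ × ℝ ↦ (p.1, p.2.1 ^ 2 + p.2.2 ^ 2))
  calc
    _ = ∫⁻ p : ℝ × ℝ × ℝ, F p.1 (p.2.1 ^ 2 + p.2.2 ^ 2) ∂(volume.prod volume) :=
      h.lintegral_comp hmeas
    _ = ∫⁻ x, ∫⁻ p : ℝ × ℝ, F x (p.1 ^ 2 + p.2 ^ 2) := lintegral_prod _ hmeas.aemeasurable
    _ = _ := by
      congr 1 with x
      have hx : Measurable (F x) := hF.of_uncurry_left
      rw [← lintegral_comp_polarCoord_symm, polarCoord_target, Measure.volume_eq_prod,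
        ← Measure.prod_restrict, lintegral_prod, ← lintegral_const_mul]
      · refine lintegral_congr fun r ↦ ?_
        have (θ : ℝ) : ENNReal.ofReal r • F x ((polarCoord.symm (r, θ)).1 ^ 2
            + (polarCoord.symm (r, θ)).2 ^ 2) = ENNReal.ofReal r * F x (r ^ 2) := by
          rw [polarCoord_symm_apply, smul_eq_mul]
          congr 2
          linear_combination r ^ 2 * Real.cos_sq_add_sin_sq θ
        simp only [this]
        rw [setLIntegral_const, Real.volume_Ioo, mul_comm, sub_neg_eq_add, ← two_mul]
      · fun_prop
      · apply Measurable.aemeasurable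
        have : Measurable fun p : ℝ × ℝ ↦ polarCoord.symm p := continuous_polarCoord_symm.measurable
        simp only [smul_eq_mul]
        exact (by fun_prop : Measurable fun p : ℝ × ℝ ↦ ENNReal.ofReal p.1).mul
          (hx.comp (by fun_prop))

theorem lintegral_gaussian_shift {a : ℝ} (ha : 0 < a) (ρ : ℝ) :
    ∫⁻ x, ENNReal.ofReal (Real.exp (-a * (x - ρ) ^ 2)) = ENNReal.ofReal √(Real.pi / a) := by
  rw [lintegral_sub_right_eq_self (fun x ↦ ENNReal.ofReal (Real.exp (-a * x ^ 2))) ρ,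
    ← ofReal_integral_eq_lintegral_ofReal (integrable_exp_neg_mul_sq ha)
      (Filter.Eventually.of_forall fun x ↦ (Real.exp_pos _).le), integral_gaussian]

theorem lintegral_exp_Iic {b : ℝ} (hb : 0 < b) (q : ℝ) :
    ∫⁻ x in Set.Iic q, ENNReal.ofReal (Real.exp (-b * (q - x))) = ENNReal.ofReal (1 / b) := by
  have h (x : ℝ) : Real.exp (-b * (q - x)) = Real.exp (-b * q) * Real.exp (b * x) := by
    rw [← Real.exp_add]
    ring_nf
  simp_rw [h]
  rw [← ofReal_integral_eq_lintegral_ofReal ((integrableOn_exp_mul_Iic hb q).const_mul _)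
      (Filter.Eventually.of_forall fun x ↦ by positivity), integral_const_mul,
      integral_exp_mul_Iic hb, ← mul_div_assoc, ← Real.exp_add]
  simp

theorem lintegral_exp_Ici {b : ℝ} (hb : 0 < b) (q : ℝ) :
    ∫⁻ x in Set.Ici (-q), ENNReal.ofReal (Real.exp (-b * (q + x))) = ENNReal.ofReal (1 / b) := by
  rw [← lintegral_exp_Iic hb q]
  have h := (Measure.measurePreserving_neg (volume : Measure ℝ)).setLIntegral_comp_preimage_emb
    (MeasurableEquiv.neg ℝ).measurableEmbedding
    (fun x ↦ ENNReal.ofReal (Real.exp (-b * (q + x)))) (Set.Ici (-q))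
  rw [← h]
  simp [sub_eq_add_neg]

/-- The sphere of radius `q` is parametrized by its axial coordinate `x`, with `q² - x²` the squared
distance to the axis. The energy weight splits as `τ ≤ m + 2πq`. For the `m` part only the axial
Gaussian is kept, giving `√(π/a)`. For the `q` part only `exp(-a(q² - x²)) ≤ exp(-aq(q - |x|))` is
kept; each end of the interval contributes at most `1/(aq)`, which absorbs the growing factor `q`.
-/
theorem lintegral_level_le {m a q τ ρ : ℝ} (hm : 0 ≤ m) (ha : 1 ≤ a) (hq : 0 < q)
    (hτ : τ ≤ m + 2 * Real.pi * q) :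
    ∫⁻ x in Set.Ioo (-q) q,
        ENNReal.ofReal (τ * Real.exp (-a * ((x - ρ) ^ 2 + (q ^ 2 - x ^ 2))))
      ≤ ENNReal.ofReal ((m * √Real.pi + 4 * Real.pi) / √a) := by
  have ha0 : 0 < a := by linarith
  have hπ := Real.pi_pos
  have haq : 0 < a * q := mul_pos ha0 hq
  have hpt (x : ℝ) (hx : x ∈ Set.Ioo (-q) q) :
      τ * Real.exp (-a * ((x - ρ) ^ 2 + (q ^ 2 - x ^ 2)))
        ≤ m * Real.exp (-a * (x - ρ) ^ 2) + 2 * Real.pi * q *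
          (Real.exp (-(a * q) * (q - x)) + Real.exp (-(a * q) * (q + x))) := by
    obtain ⟨h1, h2⟩ := hx
    have hx2 : 0 ≤ q ^ 2 - x ^ 2 := by nlinarith
    have e1 : Real.exp (-a * ((x - ρ) ^ 2 + (q ^ 2 - x ^ 2))) ≤ Real.exp (-a * (x - ρ) ^ 2) := by
      apply Real.exp_le_exp.mpr
      nlinarith
    have e2 : Real.exp (-a * ((x - ρ) ^ 2 + (q ^ 2 - x ^ 2)))
        ≤ Real.exp (-(a * q) * (q - x)) + Real.exp (-(a * q) * (q + x)) := by
      have hs := mul_nonneg ha0.le (sq_nonneg (x - ρ))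
      rcases le_total 0 x with h | h
      · refine le_add_of_le_of_nonneg (Real.exp_le_exp.mpr ?_) (Real.exp_pos _).le
        have := mul_nonneg ha0.le (mul_nonneg h (sub_nonneg.mpr h2.le))
        nlinarith
      · refine le_add_of_nonneg_of_le (Real.exp_pos _).le (Real.exp_le_exp.mpr ?_)
        have := mul_nonneg ha0.le (mul_nonneg (neg_nonneg.mpr h) (by linarith : 0 ≤ q + x))
        nlinarith
    calc
      _ ≤ (m + 2 * Real.pi * q) * Real.exp (-a * ((x - ρ) ^ 2 + (q ^ 2 - x ^ 2))) := by gcongr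
      _ ≤ _ := by
        rw [add_mul]
        gcongr
  have hreal : m * √(Real.pi / a) + 2 * Real.pi * q * (1 / (a * q) + 1 / (a * q))
      ≤ (m * √Real.pi + 4 * Real.pi) / √a := by
    have h1 : √a ≤ a := by
      rw [Real.sqrt_le_left ha0.le]
      nlinarith
    have h2 : 0 < √a := Real.sqrt_pos.mpr ha0
    rw [Real.sqrt_div hπ.le, add_div, ← mul_div_assoc]
    gcongr
    rw [show 2 * Real.pi * q * (1 / (a * q) + 1 / (a * q)) = 4 * Real.pi / a by field_simp; ring]
    gcongr
  have hIoo : MeasurableSet (Set.Ioo (-q) q) := measurableSet_Ioo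
  calc
    _ ≤ ∫⁻ x in Set.Ioo (-q) q, (ENNReal.ofReal m * ENNReal.ofReal (Real.exp (-a * (x - ρ) ^ 2))
          + ENNReal.ofReal (2 * Real.pi * q) * (ENNReal.ofReal (Real.exp (-(a * q) * (q - x)))
            + ENNReal.ofReal (Real.exp (-(a * q) * (q + x))))) := by
      refine setLIntegral_mono' hIoo fun x hx ↦ ?_
      rw [← ENNReal.ofReal_add (by positivity) (by positivity), ← ENNReal.ofReal_mul hm,
        ← ENNReal.ofReal_mul (by positivity), ← ENNReal.ofReal_add (by positivity) (by positivity)]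
      exact ENNReal.ofReal_le_ofReal (hpt x hx)
    _ = ENNReal.ofReal m * (∫⁻ x in Set.Ioo (-q) q, ENNReal.ofReal (Real.exp (-a * (x - ρ) ^ 2)))
          + ENNReal.ofReal (2 * Real.pi * q) *
            ((∫⁻ x in Set.Ioo (-q) q, ENNReal.ofReal (Real.exp (-(a * q) * (q - x))))
            + ∫⁻ x in Set.Ioo (-q) q, ENNReal.ofReal (Real.exp (-(a * q) * (q + x)))) := by
      rw [lintegral_add_left (by fun_prop), lintegral_const_mul _ (by fun_prop),
        lintegral_const_mul _ (by fun_prop), lintegral_add_left (by fun_prop)]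
    _ ≤ ENNReal.ofReal m * ENNReal.ofReal √(Real.pi / a) + ENNReal.ofReal (2 * Real.pi * q) *
          (ENNReal.ofReal (1 / (a * q)) + ENNReal.ofReal (1 / (a * q))) := by
      gcongr
      · exact (setLIntegral_le_lintegral _ _).trans_eq (lintegral_gaussian_shift ha0 ρ)
      · rw [← lintegral_exp_Iic haq q]
        exact lintegral_mono_set fun x hx ↦ hx.2.le
      · rw [← lintegral_exp_Ici haq q]
        exact lintegral_mono_set fun x hx ↦ hx.1.le
    _ ≤ _ := by
      rw [← ENNReal.ofReal_add (by positivity) (by positivity), ← ENNReal.ofReal_mul hm,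
        ← ENNReal.ofReal_mul (by positivity), ← ENNReal.ofReal_add (by positivity) (by positivity)]
      exact ENNReal.ofReal_le_ofReal hreal

/-- Integration over `r` expressed as integration over the energy `τ`. -/
theorem lintegral_radial_le {m : ℝ} (hm : 0 < m) (x : ℝ) (H : ℝ → ℝ≥0∞) :
    ∫⁻ r in Set.Ioi (0 : ℝ), ENNReal.ofReal r * H √((2 * Real.pi) ^ 2 * (x ^ 2 + r ^ 2) + m ^ 2)
      ≤ ∫⁻ τ in {τ : ℝ | 0 < τ ∧ (2 * Real.pi) ^ 2 * x ^ 2 + m ^ 2 < τ ^ 2},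
          ENNReal.ofReal (τ / (2 * Real.pi) ^ 2) * H τ := by
  have hπ := Real.pi_pos
  set c := (2 * Real.pi) ^ 2 with hc
  have hc0 : 0 < c := by positivity
  set f : ℝ → ℝ := fun r ↦ √(c * (x ^ 2 + r ^ 2) + m ^ 2) with hf
  have hpos (r : ℝ) : 0 < c * (x ^ 2 + r ^ 2) + m ^ 2 := by positivity
  have hfpos (r : ℝ) : 0 < f r := Real.sqrt_pos.mpr (hpos r)
  have hfsq (r : ℝ) : f r ^ 2 = c * (x ^ 2 + r ^ 2) + m ^ 2 := Real.sq_sqrt (hpos r).le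
  have hderiv (r : ℝ) : HasDerivAt f (c * r / f r) r := by
    have h : HasDerivAt (fun r : ℝ ↦ c * (x ^ 2 + r ^ 2) + m ^ 2) (c * (2 * r)) r := by
      simpa using (((hasDerivAt_pow 2 r).const_add (x ^ 2)).const_mul c).add_const (m ^ 2)
    convert h.sqrt (hpos r).ne' using 1
    change c * r / f r = c * (2 * r) / (2 * f r)
    have := (hfpos r).ne'
    field_simp
  have hinj : Set.InjOn f (Set.Ioi 0) := by
    intro r hr r' hr' h
    have h1 : f r ^ 2 = f r' ^ 2 := by rw [h]
    rw [hfsq, hfsq] at h1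
    have h2 : r ^ 2 = r' ^ 2 := by
      have : c * (r ^ 2 - r' ^ 2) = 0 := by linarith
      rcases mul_eq_zero.mp this with h | h
      · exact absurd h hc0.ne'
      · linarith
    exact (pow_left_inj₀ (le_of_lt hr) (le_of_lt hr') two_ne_zero).mp h2
  -- Differentiating `τ² = c(x² + r²) + m²` gives `r dr = (τ/c) dτ`.
  have key := lintegral_image_eq_lintegral_abs_deriv_mul measurableSet_Ioi
    (fun r _ ↦ (hderiv r).hasDerivWithinAt) hinj (fun τ ↦ ENNReal.ofReal (τ / c) * H τ)
  calc
    _ = ∫⁻ τ in f '' Set.Ioi 0, ENNReal.ofReal (τ / c) * H τ := by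
      rw [key]
      refine setLIntegral_congr_fun measurableSet_Ioi fun r hr ↦ ?_
      have hr' : 0 < r := hr
      have hfr := hfpos r
      change _ = _ * (_ * _)
      rw [← mul_assoc, ← ENNReal.ofReal_mul (abs_nonneg _), abs_of_pos (by positivity)]
      congr 2
      field_simp
    _ ≤ _ := by
      apply lintegral_mono_set
      rintro _ ⟨r, hr, rfl⟩
      have hr' : 0 < r := hr
      refine ⟨hfpos r, ?_⟩
      rw [hfsq]
      nlinarith [mul_pos hc0 (pow_pos hr' 2)]

/-- A coarea argument: in cylindrical coordinates the radius is exchanged for the energy `τ`,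
Tonelli puts the `τ` integral outside, and the remaining axial integral is bounded uniformly in `τ`.
-/
theorem lintegral_gaussian_energy_axis_le {m a : ℝ} (hm : 0 < m) (ha : 1 ≤ a) (k : ℝ → ℝ≥0∞)
    (hk : Measurable k) (ρ : ℝ) :
    ∫⁻ η : Space, ENNReal.ofReal (Real.exp (-a * ((η 0 - ρ) ^ 2 + (η 1 ^ 2 + η 2 ^ 2))))
        * k (energy m η)
      ≤ ENNReal.ofReal ((m * √Real.pi + 4 * Real.pi) / √a) * ∫⁻ τ, k τ := by
  have hπ := Real.pi_pos
  set c := (2 * Real.pi) ^ 2 with hc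
  have hc1 : 0 < c := by positivity
  have hE (η : Space) : energy m η = √(c * (η 0 ^ 2 + (η 1 ^ 2 + η 2 ^ 2)) + m ^ 2) := by
    rw [energy, EuclideanSpace.real_norm_sq_eq, Fin.sum_univ_three, add_assoc (η 0 ^ 2)]
  simp_rw [hE]
  rw [lintegral_cylindrical (fun x v ↦ ENNReal.ofReal (Real.exp (-a * ((x - ρ) ^ 2 + v)))
        * k √(c * (x ^ 2 + v) + m ^ 2)) (by unfold Function.uncurry; fun_prop)]
  -- On the level `τ` the squared radius is `(τ² - m²)/c - x²`.
  let H : ℝ → ℝ → ℝ≥0∞ := fun x τ ↦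
    ENNReal.ofReal (Real.exp (-a * ((x - ρ) ^ 2 + ((τ ^ 2 - m ^ 2) / c - x ^ 2)))) * k τ
  let S : Set (ℝ × ℝ) := {p | 0 < p.2 ∧ c * p.1 ^ 2 + m ^ 2 < p.2 ^ 2}
  have hS : MeasurableSet S :=
    (measurableSet_lt measurable_const measurable_snd).inter
      (measurableSet_lt (by fun_prop : Measurable fun p : ℝ × ℝ ↦ c * p.1 ^ 2 + m ^ 2)
        (by fun_prop : Measurable fun p : ℝ × ℝ ↦ p.2 ^ 2))
  let G : ℝ → ℝ → ℝ≥0∞ := fun x τ ↦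
    S.indicator (fun p ↦ ENNReal.ofReal (p.2 / c) * H p.1 p.2) (x, τ)
  have hG : Measurable (Function.uncurry G) := by
    refine Measurable.indicator ?_ hS
    fun_prop
  calc
    _ ≤ ∫⁻ x, ENNReal.ofReal (2 * Real.pi) * ∫⁻ τ, G x τ := by
      refine lintegral_mono fun x ↦ mul_le_mul_right ?_ _
      have h1 (r : ℝ) : ENNReal.ofReal (Real.exp (-a * ((x - ρ) ^ 2 + r ^ 2)))
          * k √(c * (x ^ 2 + r ^ 2) + m ^ 2) = H x √(c * (x ^ 2 + r ^ 2) + m ^ 2) := by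
        simp only [H]
        rw [Real.sq_sqrt (by positivity)]
        congr 6
        field_simp
        ring
      simp_rw [h1]
      refine (lintegral_radial_le hm x (H x)).trans_eq ?_
      exact (lintegral_indicator (measurable_prodMk_left hS :
        MeasurableSet (Prod.mk x ⁻¹' S)) _).symm
    _ = ∫⁻ τ, ENNReal.ofReal (2 * Real.pi) * ∫⁻ x, G x τ := by
      have h1 : Measurable fun x ↦ ∫⁻ τ, G x τ := hG.lintegral_prod_right'
      have h2 : Measurable fun τ ↦ ∫⁻ x, G x τ := hG.lintegral_prod_left'
      rw [lintegral_const_mul _ h1, lintegral_lintegral_swap hG.aemeasurable,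
        lintegral_const_mul _ h2]
    _ ≤ ∫⁻ τ, ENNReal.ofReal ((m * √Real.pi + 4 * Real.pi) / √a) * k τ := by
      refine lintegral_mono fun τ ↦ ?_
      -- Energies not exceeding `m` contribute nothing; otherwise the slice is the interval `(-q,
      -- q)` with `2πq = √(τ² - m²)`.
      by_cases hτ : 0 < τ ∧ m < τ
      · obtain ⟨hτ0, hτm⟩ := hτ
        have hQ : 0 < (τ ^ 2 - m ^ 2) / c := div_pos (by nlinarith) hc1
        set q := √((τ ^ 2 - m ^ 2) / c) with hq
        have hq0 : 0 < q := Real.sqrt_pos.mpr hQ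
        have hq2 : q ^ 2 = (τ ^ 2 - m ^ 2) / c := Real.sq_sqrt hQ.le
        have hτq : τ ^ 2 = m ^ 2 + (2 * Real.pi * q) ^ 2 := by
          rw [mul_pow, hq2]
          field_simp
          ring
        have hτle : τ ≤ m + 2 * Real.pi * q := by
          refine abs_le_of_sq_le_sq' ?_ (by positivity) |>.2
          rw [hτq]
          have : 0 ≤ m * (2 * Real.pi * q) := by positivity
          nlinarith
        have hSq (x : ℝ) : (x, τ) ∈ S ↔ x ∈ Set.Ioo (-q) q := by
          rw [Set.mem_Ioo, ← abs_lt, ← sq_lt_sq₀ (abs_nonneg x) hq0.le, sq_abs, hq2,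
            lt_div_iff₀ hc1]
          constructor
          · rintro ⟨-, h⟩
            have h : c * x ^ 2 + m ^ 2 < τ ^ 2 := h
            linarith
          · intro h
            exact ⟨hτ0, by change c * x ^ 2 + m ^ 2 < τ ^ 2; linarith⟩
        have hGx (x : ℝ) : G x τ = (Set.Ioo (-q) q).indicator (fun x ↦ ENNReal.ofReal (1 / c) *
            ENNReal.ofReal (τ * Real.exp (-a * ((x - ρ) ^ 2 + (q ^ 2 - x ^ 2))))) x * k τ := by
          by_cases hx : x ∈ Set.Ioo (-q) q
          · simp only [G]
            rw [Set.indicator_of_mem ((hSq x).mpr hx), Set.indicator_of_mem hx]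
            simp only [H]
            rw [← mul_assoc, ← ENNReal.ofReal_mul (by positivity),
              ← ENNReal.ofReal_mul (by positivity), hq2]
            congr 2
            ring
          · simp only [G]
            rw [Set.indicator_of_notMem (mt (hSq x).mp hx), Set.indicator_of_notMem hx, zero_mul]
        simp_rw [hGx]
        rw [lintegral_mul_const _ (by
            refine Measurable.indicator ?_ measurableSet_Ioo
            fun_prop), lintegral_indicator measurableSet_Ioo,
          lintegral_const_mul _ (by fun_prop), ← mul_assoc, ← mul_assoc,
          ← ENNReal.ofReal_mul (by positivity)]
        refine mul_le_mul_left ?_ _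
        conv_rhs => rw [← one_mul (ENNReal.ofReal _)]
        refine mul_le_mul' ?_ (lintegral_level_le hm.le ha hq0 hτle)
        -- The leftover constant is `2π/c = 1/(2π)`, which is simply bounded by one.
        rw [ENNReal.ofReal_le_one, mul_one_div, div_le_one hc1, hc]
        nlinarith [Real.pi_gt_three]
      · have (x : ℝ) : G x τ = 0 := by
          refine Set.indicator_of_notMem ?_ _
          rintro ⟨h1, h2⟩
          have h1 : 0 < τ := h1
          have h2 : c * x ^ 2 + m ^ 2 < τ ^ 2 := h2
          have h3 : 0 ≤ c * x ^ 2 := by positivity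
          exact hτ ⟨h1, by nlinarith⟩
        simp [this]
    _ = _ := lintegral_const_mul _ hk

theorem exists_linearIsometryEquiv_axis (ξ : Space) :
    ∃ (L : Space ≃ₗᵢ[ℝ] Space), L (EuclideanSpace.single 0 ‖ξ‖) = ξ := by
  refine ⟨(ℝ ∙ (EuclideanSpace.single 0 ‖ξ‖ - ξ))ᗮ.reflection, Submodule.reflection_sub ?_⟩
  simp

/-- The energy depends only on the norm, so a linear isometry moves `ξ` onto the first axis. -/
theorem lintegral_gaussian_energy_le {m a : ℝ} (hm : 0 < m) (ha : 1 ≤ a) (k : ℝ → ℝ≥0∞)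
    (hk : Measurable k) (ξ : Space) :
    ∫⁻ η : Space, ENNReal.ofReal (Real.exp (-a * ‖η - ξ‖ ^ 2)) * k (energy m η)
      ≤ ENNReal.ofReal ((m * √Real.pi + 4 * Real.pi) / √a) * ∫⁻ τ, k τ := by
  obtain ⟨L, hL⟩ := exists_linearIsometryEquiv_axis ξ
  refine le_of_eq_of_le ?_ (lintegral_gaussian_energy_axis_le hm ha k hk ‖ξ‖)
  rw [← L.measurePreserving.lintegral_comp_emb L.toHomeomorph.measurableEmbedding]
  refine lintegral_congr fun η ↦ ?_
  have h1 : energy m (L η) = energy m η := by rw [energy, L.norm_map, energy]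
  have h2 : ‖L η - ξ‖ ^ 2 = (η 0 - ‖ξ‖) ^ 2 + (η 1 ^ 2 + η 2 ^ 2) := by
    conv_lhs => rw [← hL, ← map_sub, L.norm_map, EuclideanSpace.real_norm_sq_eq,
      Fin.sum_univ_three]
    simp
    ring
  rw [h1, h2]

/-! ### Space-time estimate with a Gaussian weight -/

theorem integral_gaussian_mul_exp {V : Type*} [NormedAddCommGroup V] [InnerProductSpace ℝ V]
    [FiniteDimensional ℝ V] [MeasurableSpace V] [BorelSpace V] {b : ℝ} (hb : 0 < b) (w : V) :
    ∫ v : V, (Real.exp (-b * ‖v‖ ^ 2) : ℂ)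
        * Complex.exp ((-2 * Real.pi * inner ℝ v w : ℝ) * Complex.I)
      = ((Real.pi / b) ^ ((Module.finrank ℝ V : ℝ) / 2)
        * Real.exp (-(Real.pi ^ 2 / b) * ‖w‖ ^ 2) : ℝ) := by
  have h := fourier_gaussian_innerProductSpace (b := b) (V := V) (by simpa using hb) w
  rw [Real.fourier_eq'] at h
  push_cast at h ⊢
  rw [Complex.ofReal_cpow (by positivity)]
  push_cast
  rw [show -((Real.pi : ℂ) ^ 2 / b) * (‖w‖ : ℂ) ^ 2 = -Real.pi ^ 2 * ‖w‖ ^ 2 / b by ring, ← h]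
  congr 1 with v
  rw [smul_eq_mul, mul_comm]

/-- The phase of the plane wave with frequency `ξ` and energy `energy m ξ`. -/
def planeWave (m : ℝ) (p : ℝ × Space) (ξ : Space) : ℂ :=
  Complex.exp ((2 * Real.pi * inner ℝ p.2 ξ - p.1 * energy m ξ : ℝ) * Complex.I)

@[fun_prop]
theorem continuous_planeWave (m : ℝ) : Continuous (Function.uncurry (planeWave m)) := by
  unfold planeWave Function.uncurry
  fun_prop

theorem norm_planeWave (m : ℝ) (p : ℝ × Space) (ξ : Space) : ‖planeWave m p ξ‖ = 1 :=
  Complex.norm_exp_ofReal_mul_I _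

theorem integrable_gaussian_norm {V : Type*} [NormedAddCommGroup V] [InnerProductSpace ℝ V]
    [FiniteDimensional ℝ V] [MeasurableSpace V] [BorelSpace V] {b : ℝ} (hb : 0 < b) :
    Integrable fun v : V ↦ Real.exp (-b * ‖v‖ ^ 2) := by
  have h := (GaussianFourier.integrable_cexp_neg_mul_sq_norm_add (V := V) (b := b)
    (by simpa using hb) 0 0).norm
  simpa [Complex.norm_exp, ← Complex.ofReal_pow] using h

/-- This is the kernel of `T*T`: the integrand factors into Gaussian Fourier integrals in time, at
frequency `(E(ξ) - E(η))/(2π)`, and in space, at frequency `η - ξ`. -/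
theorem integral_planeWave_mul_conj (m : ℝ) {ε l : ℝ} (hε : 0 < ε) (hl : 0 < l) (ξ η : Space) :
    ∫ p : ℝ × Space, (Real.exp (-ε * p.1 ^ 2) * Real.exp (-l * ‖p.2‖ ^ 2) : ℂ)
        * (planeWave m p ξ * conj (planeWave m p η))
      = ((√(Real.pi / ε) * Real.exp (-(1 / (4 * ε)) * (energy m η - energy m ξ) ^ 2))
        * ((Real.pi / l) ^ ((3 : ℝ) / 2) * Real.exp (-(Real.pi ^ 2 / l) * ‖η - ξ‖ ^ 2)) : ℝ) := by
  have hπ := Real.pi_pos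
  have h1 := integral_gaussian_mul_exp hε ((energy m ξ - energy m η) / (2 * Real.pi))
  have h2 := integral_gaussian_mul_exp hl (η - ξ)
  rw [finrank_euclideanSpace_fin, Nat.cast_ofNat] at h2
  rw [Module.finrank_self] at h1
  have e1 : -(Real.pi ^ 2 / ε) * ‖(energy m ξ - energy m η) / (2 * Real.pi)‖ ^ 2
      = -(1 / (4 * ε)) * (energy m η - energy m ξ) ^ 2 := by
    rw [Real.norm_eq_abs, sq_abs]
    field_simp
    ring
  rw [e1, Nat.cast_one, ← Real.sqrt_eq_rpow] at h1
  rw [Complex.ofReal_mul, ← h1, ← h2, ← integral_prod_mul]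
  congr 1 with p
  have h3 : planeWave m p ξ * conj (planeWave m p η)
      = Complex.exp ((-2 * Real.pi * inner ℝ p.1 ((energy m ξ - energy m η) / (2 * Real.pi)) : ℝ)
          * Complex.I) * Complex.exp ((-2 * Real.pi * inner ℝ p.2 (η - ξ) : ℝ) * Complex.I) := by
    rw [planeWave, planeWave, ← Complex.exp_conj, ← Complex.exp_add, ← Complex.exp_add]
    congr 1
    rw [map_mul, Complex.conj_ofReal, Complex.conj_I, inner_sub_right]
    simp only [RCLike.inner_apply, conj_trivial]
    push_cast
    have : (Real.pi : ℂ) ≠ 0 := by exact_mod_cast hπ.ne'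
    field_simp
    ring
  rw [h3, Real.norm_eq_abs, sq_abs]
  ring

/-- The constant of the space-time estimate. -/
def smoothingConst (m : ℝ) : ℝ := 2 * Real.pi * √Real.pi * (m * √Real.pi + 4 * Real.pi)

theorem lintegral_kernel_energy_le {m ε l : ℝ} (hm : 0 < m) (hε : 0 < ε) (hl : 0 < l)
    (hl1 : l ≤ 1) (ξ : Space) :
    ∫⁻ η, ENNReal.ofReal ((√(Real.pi / ε)
          * Real.exp (-(1 / (4 * ε)) * (energy m η - energy m ξ) ^ 2))
        * ((Real.pi / l) ^ ((3 : ℝ) / 2) * Real.exp (-(Real.pi ^ 2 / l) * ‖η - ξ‖ ^ 2)))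
      ≤ ENNReal.ofReal (smoothingConst m / l) := by
  have hπ := Real.pi_pos
  have ha : 1 ≤ Real.pi ^ 2 / l := by
    rw [one_le_div hl]
    nlinarith [Real.pi_gt_three]
  let k : ℝ → ℝ≥0∞ := fun τ ↦ ENNReal.ofReal (Real.exp (-(1 / (4 * ε)) * (τ - energy m ξ) ^ 2))
  have hk : Measurable k := by fun_prop
  have hkint : ∫⁻ τ, k τ = ENNReal.ofReal √(Real.pi / (1 / (4 * ε))) :=
    lintegral_gaussian_shift (by positivity) _
  have hc : √(Real.pi / ε) * (Real.pi / l) ^ ((3 : ℝ) / 2) *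
      ((m * √Real.pi + 4 * Real.pi) / √(Real.pi ^ 2 / l) * √(Real.pi / (1 / (4 * ε))))
      = smoothingConst m / l := by
    have h1 : (Real.pi / l) ^ ((3 : ℝ) / 2) = Real.pi / l * √(Real.pi / l) := by
      rw [Real.sqrt_eq_rpow, ← Real.rpow_one_add' (by positivity) (by norm_num)]
      norm_num
    -- The height of the time kernel and the mass of the energy Gaussian are inverse in `ε`; their
    -- product is independent of it.
    have h2 : √(Real.pi / ε) * √(Real.pi / (1 / (4 * ε))) = 2 * Real.pi := by
      rw [← Real.sqrt_mul (by positivity), show Real.pi / ε * (Real.pi / (1 / (4 * ε)))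
        = (2 * Real.pi) ^ 2 by field_simp; ring, Real.sqrt_sq (by positivity)]
    have h3 : √(Real.pi ^ 2 / l) = Real.pi / √l := by
      rw [Real.sqrt_div (by positivity), Real.sqrt_sq hπ.le]
    have h4 : √(Real.pi / l) = √Real.pi / √l := Real.sqrt_div hπ.le _
    have h5 : 0 < √l := Real.sqrt_pos.mpr hl
    calc
      _ = (√(Real.pi / ε) * √(Real.pi / (1 / (4 * ε)))) * (Real.pi / l * (√Real.pi / √l)) *
          ((m * √Real.pi + 4 * Real.pi) / (Real.pi / √l)) := by
        rw [h1, h3, h4]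
        ring
      _ = _ := by
        rw [h2, smoothingConst]
        field_simp
  calc
    _ = ∫⁻ η, ENNReal.ofReal (√(Real.pi / ε) * (Real.pi / l) ^ ((3 : ℝ) / 2)) *
          (ENNReal.ofReal (Real.exp (-(Real.pi ^ 2 / l) * ‖η - ξ‖ ^ 2)) * k (energy m η)) := by
      refine lintegral_congr fun η ↦ ?_
      simp only [k]
      rw [← ENNReal.ofReal_mul (by positivity), ← ENNReal.ofReal_mul (by positivity)]
      congr 1
      ring
    _ = ENNReal.ofReal (√(Real.pi / ε) * (Real.pi / l) ^ ((3 : ℝ) / 2)) *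
          ∫⁻ η, ENNReal.ofReal (Real.exp (-(Real.pi ^ 2 / l) * ‖η - ξ‖ ^ 2)) * k (energy m η) :=
      lintegral_const_mul _ (by fun_prop)
    _ ≤ ENNReal.ofReal (√(Real.pi / ε) * (Real.pi / l) ^ ((3 : ℝ) / 2)) *
          (ENNReal.ofReal ((m * √Real.pi + 4 * Real.pi) / √(Real.pi ^ 2 / l)) * ∫⁻ τ, k τ) := by
      gcongr
      exact lintegral_gaussian_energy_le hm ha k hk ξ
    _ = _ := by
      rw [hkint, ← ENNReal.ofReal_mul (by positivity), ← ENNReal.ofReal_mul (by positivity), hc]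

theorem lintegral_planeWave_regularized_le {m ε l : ℝ} (hm : 0 < m) (hε : 0 < ε) (hl : 0 < l)
    (hl1 : l ≤ 1) (f : Space → ℂ) (hf : Measurable f) (hfint : Integrable f) :
    ∫⁻ t, ENNReal.ofReal (Real.exp (-ε * t ^ 2)) *
        ∫⁻ x, ENNReal.ofReal (Real.exp (-l * ‖x‖ ^ 2)) * ‖∫ ξ, planeWave m (t, x) ξ * f ξ‖ₑ ^ 2
      ≤ ENNReal.ofReal (smoothingConst m / l) * ∫⁻ ξ, ‖f ξ‖ₑ ^ 2 := by
  -- The exponents are halved so that `w²` is the full weight. The time Gaussian makes `w²`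
  -- integrable on space-time.
  let w : ℝ × Space → ℝ := fun p ↦ Real.exp (-(ε / 2) * p.1 ^ 2) * Real.exp (-(l / 2) * ‖p.2‖ ^ 2)
  have hw0 (p : ℝ × Space) : 0 < w p := by positivity
  have hw2 (p : ℝ × Space) : w p ^ 2 = Real.exp (-ε * p.1 ^ 2) * Real.exp (-l * ‖p.2‖ ^ 2) := by
    simp only [w]
    rw [mul_pow, ← Real.exp_nat_mul, ← Real.exp_nat_mul]
    congr 2 <;> push_cast <;> ring
  have hwint : Integrable (fun p ↦ w p ^ 2) (volume.prod volume) := by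
    simp_rw [hw2]
    exact (integrable_exp_neg_mul_sq hε).mul_prod (integrable_gaussian_norm hl)
  have key := lintegral_enorm_sq_integral_le (volume.prod volume : Measure (ℝ × Space)) volume
    (fun p ξ ↦ (w p : ℂ) * planeWave m p ξ)
    (by
      have h := continuous_planeWave m
      have hw : Continuous w := by fun_prop
      exact ((Complex.continuous_ofReal.comp (hw.comp continuous_fst)).mul h).measurable)
    w hwint (fun p ξ ↦ by
      rw [norm_mul, norm_planeWave, mul_one, Complex.norm_real, Real.norm_of_nonneg (hw0 p).le])
    f hf hfint (ENNReal.ofReal (smoothingConst m / l)) (fun ξ ↦ by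
      refine le_of_eq_of_le (lintegral_congr fun η ↦ ?_)
        (lintegral_kernel_energy_le hm hε hl hl1 ξ)
      rw [← ofReal_norm]
      congr 1
      rw [← Real.norm_of_nonneg (by positivity : 0 ≤ (√(Real.pi / ε)
          * Real.exp (-(1 / (4 * ε)) * (energy m η - energy m ξ) ^ 2))
        * ((Real.pi / l) ^ ((3 : ℝ) / 2) * Real.exp (-(Real.pi ^ 2 / l) * ‖η - ξ‖ ^ 2))),
        ← Complex.norm_real, ← integral_planeWave_mul_conj m hε hl ξ η]
      congr 2 with p
      rw [map_mul, Complex.conj_ofReal, ← Complex.ofReal_mul, ← hw2]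
      push_cast
      ring)
  refine le_of_eq_of_le ?_ key
  have hint (p : ℝ × Space) : ∫ ξ, (w p : ℂ) * planeWave m p ξ * f ξ
      = w p * ∫ ξ, planeWave m p ξ * f ξ := by
    simp_rw [mul_assoc]
    exact integral_const_mul _ _
  have hmeas : StronglyMeasurable fun p ↦ ∫ ξ, planeWave m p ξ * f ξ := by
    have : StronglyMeasurable (Function.uncurry fun p ξ ↦ planeWave m p ξ * f ξ) :=
      ((continuous_planeWave m).measurable.mul (hf.comp measurable_snd)).stronglyMeasurable
    exact this.integral_prod_right
  have hmeas' : Measurable fun p : ℝ × Space ↦ ENNReal.ofReal (w p ^ 2) *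
      ‖∫ ξ, planeWave m p ξ * f ξ‖ₑ ^ 2 := by
    have hw : Continuous w := by fun_prop
    exact (hw.pow 2).measurable.ennreal_ofReal.mul (hmeas.measurable.enorm.pow_const 2)
  have heq (p : ℝ × Space) : ‖∫ ξ, (w p : ℂ) * planeWave m p ξ * f ξ‖ₑ ^ 2
      = ENNReal.ofReal (w p ^ 2) * ‖∫ ξ, planeWave m p ξ * f ξ‖ₑ ^ 2 := by
    rw [hint, enorm_mul, mul_pow, ENNReal.ofReal_pow (hw0 p).le, ← ofReal_norm (w p : ℂ),
      Complex.norm_real, Real.norm_of_nonneg (hw0 p).le]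
  simp_rw [heq]
  rw [lintegral_prod _ hmeas'.aemeasurable]
  refine lintegral_congr fun t ↦ ?_
  rw [← lintegral_const_mul']
  · refine lintegral_congr fun x ↦ ?_
    rw [hw2, ENNReal.ofReal_mul (Real.exp_pos _).le, mul_assoc]
  · exact ENNReal.ofReal_ne_top

/-- Fatou's lemma with bounds that may vary. It serves twice: to remove the cutoff `ε`, and to pass
from Schwartz data to `L²` data. -/
theorem lintegral_le_of_tendsto {α : Type*} [MeasurableSpace α] {μ : Measure α}
    {F : ℕ → α → ℝ≥0∞} {G : α → ℝ≥0∞} (hF : ∀ n, Measurable (F n))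
    (h : ∀ x, Filter.Tendsto (fun n ↦ F n x) Filter.atTop (nhds (G x))) {B : ℕ → ℝ≥0∞}
    {B₀ : ℝ≥0∞} (hB : ∀ n, ∫⁻ x, F n x ∂μ ≤ B n)
    (hB₀ : Filter.Tendsto B Filter.atTop (nhds B₀)) : ∫⁻ x, G x ∂μ ≤ B₀ :=
  calc
    _ = ∫⁻ x, Filter.liminf (fun n ↦ F n x) Filter.atTop ∂μ :=
      lintegral_congr fun x ↦ (h x).liminf_eq.symm
    _ ≤ Filter.liminf (fun n ↦ ∫⁻ x, F n x ∂μ) Filter.atTop := lintegral_liminf_le hF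
    _ ≤ Filter.liminf B Filter.atTop :=
      Filter.liminf_le_liminf (Filter.Eventually.of_forall hB)
    _ = B₀ := hB₀.liminf_eq

theorem measurable_lintegral_planeWave (m l : ℝ) (f : Space → ℂ) (hf : Measurable f) :
    Measurable fun p : ℝ × Space ↦
      ENNReal.ofReal (Real.exp (-l * ‖p.2‖ ^ 2)) * ‖∫ ξ, planeWave m p ξ * f ξ‖ₑ ^ 2 := by
  have hmeas : StronglyMeasurable fun p ↦ ∫ ξ, planeWave m p ξ * f ξ := by
    have : StronglyMeasurable (Function.uncurry fun p ξ ↦ planeWave m p ξ * f ξ) :=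
      ((continuous_planeWave m).measurable.mul (hf.comp measurable_snd)).stronglyMeasurable
    exact this.integral_prod_right
  exact (by fun_prop : Measurable fun p : ℝ × Space ↦
    ENNReal.ofReal (Real.exp (-l * ‖p.2‖ ^ 2))).mul (hmeas.measurable.enorm.pow_const 2)

theorem lintegral_planeWave_le {m l : ℝ} (hm : 0 < m) (hl : 0 < l)
    (hl1 : l ≤ 1) (f : Space → ℂ) (hf : Measurable f) (hfint : Integrable f) :
    ∫⁻ t, ∫⁻ x, ENNReal.ofReal (Real.exp (-l * ‖x‖ ^ 2)) * ‖∫ ξ, planeWave m (t, x) ξ * f ξ‖ₑ ^ 2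
      ≤ ENNReal.ofReal (smoothingConst m / l) * ∫⁻ ξ, ‖f ξ‖ₑ ^ 2 := by
  have hmeas : Measurable fun t ↦ ∫⁻ x : Space,
      ENNReal.ofReal (Real.exp (-l * ‖x‖ ^ 2)) * ‖∫ ξ, planeWave m (t, x) ξ * f ξ‖ₑ ^ 2 :=
    (measurable_lintegral_planeWave m l f hf).lintegral_prod_right'
  refine lintegral_le_of_tendsto (F := fun n t ↦
    ENNReal.ofReal (Real.exp (-(1 / ((n : ℝ) + 1)) * t ^ 2)) * ∫⁻ x,
      ENNReal.ofReal (Real.exp (-l * ‖x‖ ^ 2)) * ‖∫ ξ, planeWave m (t, x) ξ * f ξ‖ₑ ^ 2)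
    (fun n ↦ (by fun_prop : Measurable fun t : ℝ ↦
      ENNReal.ofReal (Real.exp (-(1 / ((n : ℝ) + 1)) * t ^ 2))).mul hmeas) (fun t ↦ ?_)
    (fun n ↦ lintegral_planeWave_regularized_le hm (by positivity) hl hl1 f hf hfint)
    tendsto_const_nhds
  have h1 : Filter.Tendsto (fun n : ℕ ↦
      ENNReal.ofReal (Real.exp (-(1 / ((n : ℝ) + 1)) * t ^ 2))) Filter.atTop (nhds 1) := by
    have h2 : Filter.Tendsto (fun n : ℕ ↦ Real.exp (-(1 / ((n : ℝ) + 1)) * t ^ 2))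
        Filter.atTop (nhds (Real.exp (-0 * t ^ 2))) :=
      (Real.continuous_exp.tendsto _).comp
        ((tendsto_one_div_add_atTop_nhds_zero_nat.neg).mul_const _)
    simpa using ENNReal.tendsto_ofReal h2
  simpa using ENNReal.Tendsto.mul_const h1 (Or.inl one_ne_zero)

/-! ### The smoothing estimate in `L²` -/

/-- The two inverse transforms agree when tested against smooth compactly supported functions, since
both are transposed onto the test function; for the integral this is Fubini with the symmetric
pairing `-innerₗ Space`. -/
theorem fourierInv_ae_eq (f : L2) (hf : Integrable f) :
    (𝓕⁻ f : L2) =ᵐ[volume] 𝓕⁻ (f : Space → Spinor) := by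
  have hcont : Continuous (𝓕⁻ (f : Space → Spinor)) := by
    refine VectorFourier.fourierIntegral_continuous Real.continuous_fourierChar ?_ hf
    change Continuous fun p : Space × Space ↦ -inner ℝ p.1 p.2
    fun_prop
  apply ae_eq_of_integral_contDiff_smul_eq (locallyIntegrable_coeFn _) hcont.locallyIntegrable
  intro u u_smooth u_cpt
  have hu₁ : HasCompactSupport (Complex.ofRealCLM ∘ u) := u_cpt.comp_left rfl
  have hu₂ : ContDiff ℝ ((⊤ : ℕ∞) : WithTop ℕ∞) (Complex.ofRealCLM ∘ u) := by fun_prop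
  set U : 𝓢(Space, ℂ) := hu₁.toSchwartzMap hu₂
  have hflip : ∫ ξ, (𝓕⁻ (U : Space → ℂ)) ξ • f ξ = ∫ x, U x • (𝓕⁻ (f : Space → Spinor)) x := by
    have h := VectorFourier.integral_fourierIntegral_smul_eq_flip (μ := volume) (ν := volume)
      (L := -innerₗ Space) (f := U) (g := f) Real.continuous_fourierChar
      (by
        change Continuous fun p : Space × Space ↦ -inner ℝ p.1 p.2
        fun_prop) U.integrable hf
    have hL : (-innerₗ Space).flip = -innerₗ Space := by
      ext x y
      simp [real_inner_comm]
    rw [hL] at h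
    exact h
  have h1 : ((𝓕⁻ f : L2) : 𝓢'(Space, Spinor)) U = (f : 𝓢'(Space, Spinor)) (𝓕⁻ U) := by
    rw [← Lp.fourierInv_toTemperedDistribution_eq]
    rfl
  simp only [Lp.toTemperedDistribution_apply] at h1
  calc
    _ = ∫ x, U x • (𝓕⁻ f : L2) x := by simp [U]
    _ = ∫ ξ, (𝓕⁻ U) ξ • f ξ := h1
    _ = ∫ x, U x • (𝓕⁻ (f : Space → Spinor)) x := by
      rw [← hflip, SchwartzMap.fourierInv_coe]
    _ = _ := by simp [U]

theorem enorm_sq_eq_lintegral (g : L2) : ‖g‖ₑ ^ 2 = ∫⁻ x, ‖g x‖ₑ ^ 2 := by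
  have h := eLpNorm_nnreal_pow_eq_lintegral (μ := (volume : Measure Space)) (f := g)
    (p := 2) two_ne_zero
  rw [Lp.enorm_def]
  simpa using h

theorem spinor_enorm_sq (v : Spinor) : ‖v‖ₑ ^ 2 = ∑ i, ‖v i‖ₑ ^ 2 := by
  simp_rw [← ofReal_norm, ← ENNReal.ofReal_pow (norm_nonneg _)]
  rw [EuclideanSpace.norm_sq_eq, ENNReal.ofReal_sum_of_nonneg fun i _ ↦ sq_nonneg _]

/-- The multiplication by the Gaussian `exp (-l |x|² / 2)`. -/
def gaussianSymbol (l : ℝ) (hl : 0 < l) : Symbol :=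
  scalarSymbol (fun x ↦ (Real.exp (-(l / 2) * ‖x‖ ^ 2) : ℂ)) (by fun_prop) 1 (fun x ↦ by
    rw [Complex.norm_real, Real.norm_of_nonneg (Real.exp_pos _).le, Real.exp_le_one_iff]
    have : 0 ≤ l / 2 * ‖x‖ ^ 2 := by positivity
    linarith)

theorem enorm_sq_multiplier_gaussianSymbol {l : ℝ} (hl : 0 < l) (g : L2) :
    ‖multiplier (gaussianSymbol l hl) g‖ₑ ^ 2
      = ∫⁻ x, ENNReal.ofReal (Real.exp (-l * ‖x‖ ^ 2)) * ‖g x‖ₑ ^ 2 := by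
  rw [enorm_sq_eq_lintegral]
  apply lintegral_congr_ae
  filter_upwards [coeFn_multiplier (gaussianSymbol l hl) g] with x hx
  rw [hx, gaussianSymbol, scalarSymbol_apply, enorm_smul, mul_pow, ← ofReal_norm,
    Complex.norm_real, Real.norm_of_nonneg (Real.exp_pos _).le,
    ← ENNReal.ofReal_pow (Real.exp_pos _).le, ← Real.exp_nat_mul]
  congr 3
  push_cast
  ring

theorem fourierInv_multiplier_phaseSymbol (m t : ℝ) (f : 𝓢(Space, Spinor)) :
    (𝓕⁻ (multiplier (phaseSymbol m t) (f.toLp 2 : L2)) : L2)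
      =ᵐ[volume] fun x ↦ ∫ ξ, planeWave m (t, x) ξ • f ξ := by
  have h1 : multiplier (phaseSymbol m t) (f.toLp 2 : L2) =ᵐ[volume]
      fun ξ ↦ Complex.exp (-(t * energy m ξ : ℝ) * Complex.I) • f ξ := by
    filter_upwards [coeFn_multiplier (phaseSymbol m t) (f.toLp 2 : L2),
      f.coeFn_toLp 2 volume] with ξ h1 h2
    rw [h1, h2]
    rfl
  have hint : Integrable (multiplier (phaseSymbol m t) (f.toLp 2 : L2)) := by
    refine f.integrable.mono (Lp.aestronglyMeasurable _) ?_
    filter_upwards [h1] with ξ h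
    rw [h, norm_smul, ← Complex.ofReal_neg, Complex.norm_exp_ofReal_mul_I, one_mul]
  filter_upwards [fourierInv_ae_eq _ hint] with x hx
  rw [hx, Real.fourierInv_eq']
  apply integral_congr_ae
  filter_upwards [h1] with ξ hξ
  rw [hξ, smul_smul, ← Complex.exp_add, planeWave, real_inner_comm]
  congr 2
  push_cast
  ring

theorem integral_planeWave_apply (m : ℝ) (p : ℝ × Space) (f : 𝓢(Space, Spinor)) (i : Fin 4) :
    (∫ ξ, planeWave m p ξ • f ξ) i = ∫ ξ, planeWave m p ξ * f ξ i := by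
  have hint : Integrable fun ξ ↦ planeWave m p ξ • f ξ := by
    refine f.integrable.mono ?_ ?_
    · have h : Continuous (planeWave m p) := by fun_prop
      exact (h.smul f.continuous).aestronglyMeasurable
    · filter_upwards with ξ
      rw [norm_smul, norm_planeWave, one_mul]
  exact ((EuclideanSpace.proj i : Spinor →L[ℂ] ℂ).integral_comp_comm hint).symm

/-- The phase is scalar, so the scalar estimate is applied to each spinor component and the four
bounds are added. -/
theorem lintegral_phaseSymbol_schwartz_le {m l : ℝ} (hm : 0 < m) (hl : 0 < l) (hl1 : l ≤ 1)
    (f : 𝓢(Space, Spinor)) :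
    ∫⁻ t, ‖multiplier (gaussianSymbol l hl)
        (𝓕⁻ (multiplier (phaseSymbol m t) (f.toLp 2 : L2)) : L2)‖ₑ ^ 2
      ≤ ENNReal.ofReal (smoothingConst m / l) * ‖(f.toLp 2 : L2)‖ₑ ^ 2 := by
  have hfm (i : Fin 4) : Measurable fun ξ ↦ f ξ i :=
    ((EuclideanSpace.proj i : Spinor →L[ℂ] ℂ).continuous.comp f.continuous).measurable
  have hfi (i : Fin 4) : Integrable fun ξ ↦ f ξ i :=
    (EuclideanSpace.proj i : Spinor →L[ℂ] ℂ).integrable_comp f.integrable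
  obtain ⟨G, hG⟩ : ∃ G : Fin 4 → ℝ × Space → ℝ≥0∞, G = fun i p ↦
    ENNReal.ofReal (Real.exp (-l * ‖p.2‖ ^ 2)) * ‖∫ ξ, planeWave m p ξ * f ξ i‖ₑ ^ 2 := ⟨_, rfl⟩
  have hGm (i : Fin 4) : Measurable (G i) := by
    rw [hG]
    exact measurable_lintegral_planeWave m l (fun ξ ↦ f ξ i) (hfm i)
  have hGt (i : Fin 4) (t : ℝ) : Measurable fun x ↦ G i (t, x) :=
    (hGm i).comp measurable_prodMk_left
  have hGle (i : Fin 4) : ∫⁻ t, ∫⁻ x, G i (t, x)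
      ≤ ENNReal.ofReal (smoothingConst m / l) * ∫⁻ ξ, ‖f ξ i‖ₑ ^ 2 := by
    rw [hG]
    exact lintegral_planeWave_le hm hl hl1 _ (hfm i) (hfi i)
  calc
    _ = ∫⁻ t, ∑ i, ∫⁻ x, G i (t, x) := by
      refine lintegral_congr fun t ↦ ?_
      rw [enorm_sq_multiplier_gaussianSymbol, ← lintegral_finsetSum _ fun i _ ↦ hGt i t]
      apply lintegral_congr_ae
      filter_upwards [fourierInv_multiplier_phaseSymbol m t f] with x hx
      rw [hx, spinor_enorm_sq, Finset.mul_sum, hG]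
      simp_rw [integral_planeWave_apply]
    _ = ∑ i, ∫⁻ t, ∫⁻ x, G i (t, x) :=
      lintegral_finsetSum _ fun i _ ↦ (hGm i).lintegral_prod_right'
    _ ≤ ∑ i, ENNReal.ofReal (smoothingConst m / l) * ∫⁻ ξ, ‖f ξ i‖ₑ ^ 2 :=
      Finset.sum_le_sum fun i _ ↦ hGle i
    _ = _ := by
      rw [← Finset.mul_sum, enorm_sq_eq_lintegral,
        ← lintegral_finsetSum _ fun i _ ↦ (hfm i).enorm.pow_const 2]
      congr 1
      apply lintegral_congr_ae
      filter_upwards [f.coeFn_toLp 2 volume] with ξ hξ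
      rw [hξ, spinor_enorm_sq]

theorem lintegral_phaseSymbol_le {m l : ℝ} (hm : 0 < m) (hl : 0 < l) (hl1 : l ≤ 1) (f : L2) :
    ∫⁻ t, ‖multiplier (gaussianSymbol l hl) (𝓕⁻ (multiplier (phaseSymbol m t) f) : L2)‖ₑ ^ 2
      ≤ ENNReal.ofReal (smoothingConst m / l) * ‖f‖ₑ ^ 2 := by
  obtain ⟨F, hF, hlim⟩ := mem_closure_iff_seq_limit.mp
    (SchwartzMap.denseRange_toLpCLM (F := Spinor) (p := 2)
      (μ := (volume : Measure Space)) ENNReal.ofNat_ne_top f)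
  have hFi : Continuous fun g : L2 ↦ (𝓕⁻ g : L2) :=
    (Lp.fourierTransformₗᵢ Space Spinor).symm.continuous
  refine lintegral_le_of_tendsto (F := fun n t ↦ ‖multiplier (gaussianSymbol l hl)
      (𝓕⁻ (multiplier (phaseSymbol m t) (F n)) : L2)‖ₑ ^ 2) (fun n ↦ ?_) (fun t ↦ ?_)
    (B := fun n ↦ ENNReal.ofReal (smoothingConst m / l) * ‖F n‖ₑ ^ 2) (fun n ↦ ?_) ?_
  · have h : Continuous fun t ↦ multiplier (gaussianSymbol l hl)
      (𝓕⁻ (multiplier (phaseSymbol m t) (F n)) : L2) :=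
      (multiplier (gaussianSymbol l hl)).continuous.comp
        (hFi.comp (continuous_multiplier_phaseSymbol m (F n)))
    exact (continuous_enorm.comp h).measurable.pow_const 2
  · have h : Continuous fun g : L2 ↦ multiplier (gaussianSymbol l hl)
      (𝓕⁻ (multiplier (phaseSymbol m t) g) : L2) :=
      (multiplier (gaussianSymbol l hl)).continuous.comp
        (hFi.comp (multiplier (phaseSymbol m t)).continuous)
    exact (((ENNReal.continuous_pow 2).comp (continuous_enorm.comp h)).tendsto f).comp hlim
  · obtain ⟨g, hg⟩ := hF n
    rw [← hg]
    exact lintegral_phaseSymbol_schwartz_le hm hl hl1 g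
  · refine ENNReal.Tendsto.const_mul ?_ (Or.inr ENNReal.ofReal_ne_top)
    exact (((ENNReal.continuous_pow 2).comp continuous_enorm).tendsto f).comp hlim

theorem lintegral_evolutionPart_le {m l σ : ℝ} (hm : 0 < m) (hl : 0 < l) (hl1 : l ≤ 1)
    (hσ : σ * σ = 1) (f : L2) :
    ∫⁻ t, ‖multiplier (gaussianSymbol l hl) (evolutionPart m hm σ t f)‖ₑ ^ 2
      ≤ ENNReal.ofReal (smoothingConst m / l) * ‖f‖ₑ ^ 2 := by
  set g := multiplier (energyProjection m hm σ) (𝓕 f) with hg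
  have hgf : ‖g‖ₑ ≤ ‖f‖ₑ := by
    rw [← ofReal_norm, ← ofReal_norm]
    refine ENNReal.ofReal_le_ofReal ((norm_energyProjection_apply_le hm hσ _).trans_eq ?_)
    exact Lp.norm_fourier_eq f
  have h := lintegral_phaseSymbol_le hm hl hl1 g
  have heq : ∫⁻ t, ‖multiplier (gaussianSymbol l hl) (evolutionPart m hm σ t f)‖ₑ ^ 2
      = ∫⁻ t, ‖multiplier (gaussianSymbol l hl) (𝓕⁻ (multiplier (phaseSymbol m t) g) : L2)‖ₑ ^ 2 := by
    -- The negative-energy phase is the positive one with time reversed, and `t ↦ -t` preserves the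
    -- time integral.
    rcases mul_self_eq_one_iff.mp hσ with rfl | rfl
    · simp only [evolutionPart, one_mul, hg]
    · rw [← lintegral_neg_eq_self]
      simp only [evolutionPart, neg_one_mul, neg_neg, hg]
  rw [heq]
  refine h.trans ?_
  gcongr

theorem enorm_add_sq_le {E : Type*} [NormedAddCommGroup E] (v w : E) :
    ‖v + w‖ₑ ^ 2 ≤ 2 * (‖v‖ₑ ^ 2 + ‖w‖ₑ ^ 2) := by
  refine (pow_le_pow_left' (enorm_add_le v w) 2).trans ?_
  simp only [enorm_eq_nnnorm]
  exact_mod_cast add_sq_le (a := ‖v‖₊) (b := ‖w‖₊)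

theorem lintegral_evolution_le {m l : ℝ} (hm : 0 < m) (hl : 0 < l) (hl1 : l ≤ 1) (f : L2) :
    ∫⁻ t, ‖multiplier (gaussianSymbol l hl)
        (evolutionPart m hm 1 t f + evolutionPart m hm (-1) t f)‖ₑ ^ 2
      ≤ ENNReal.ofReal (4 * (smoothingConst m / l)) * ‖f‖ₑ ^ 2 := by
  have hmeas (σ : ℝ) : Measurable fun t ↦
      ‖multiplier (gaussianSymbol l hl) (evolutionPart m hm σ t f)‖ₑ ^ 2 :=
    (continuous_enorm.comp ((multiplier (gaussianSymbol l hl)).continuous.comp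
      (continuous_evolutionPart hm σ f))).measurable.pow_const 2
  calc
    _ ≤ ∫⁻ t, 2 * (‖multiplier (gaussianSymbol l hl) (evolutionPart m hm 1 t f)‖ₑ ^ 2
          + ‖multiplier (gaussianSymbol l hl) (evolutionPart m hm (-1) t f)‖ₑ ^ 2) := by
      refine lintegral_mono fun t ↦ ?_
      rw [map_add]
      exact enorm_add_sq_le _ _
    _ = 2 * (∫⁻ t, ‖multiplier (gaussianSymbol l hl) (evolutionPart m hm 1 t f)‖ₑ ^ 2)
          + 2 * ∫⁻ t, ‖multiplier (gaussianSymbol l hl) (evolutionPart m hm (-1) t f)‖ₑ ^ 2 := by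
      rw [lintegral_const_mul' _ _ ENNReal.ofNat_ne_top, lintegral_add_left (hmeas 1), mul_add]
    _ ≤ 2 * (ENNReal.ofReal (smoothingConst m / l) * ‖f‖ₑ ^ 2)
          + 2 * (ENNReal.ofReal (smoothingConst m / l) * ‖f‖ₑ ^ 2) := by
      gcongr
      · exact lintegral_evolutionPart_le hm hl hl1 (by norm_num) f
      · exact lintegral_evolutionPart_le hm hl hl1 (by norm_num) f
    _ = _ := by
      rw [ENNReal.ofReal_mul (by norm_num), ENNReal.ofReal_ofNat]
      ring

/-! ### From Gaussian weights to the polynomial weight. -/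

theorem exists_rpow_neg_le_gaussian {s v : ℝ} (hs : 0 ≤ s) (hv : 0 ≤ v) :
    ∃ k : ℕ, (1 + v) ^ (-s)
      ≤ Real.exp 4 * ((4 : ℝ) ^ (-s)) ^ k * Real.exp (-(1 / 4 : ℝ) ^ k * v) := by
  -- With `4^k ≤ 1 + v < 4^(k+1)`, the power is at most `4^(-sk)`, while `4^(-k) v ≤ 4` keeps the
  -- Gaussian above `exp(-4)`; this explains the factor `exp 4`.
  obtain ⟨k, h1, h2⟩ := exists_nat_pow_near (x := 1 + v) (y := 4) (by linarith) (by norm_num)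
  refine ⟨k, ?_⟩
  have h3 : (1 + v) ^ (-s) ≤ ((4 : ℝ) ^ (-s)) ^ k := by
    rw [← Real.rpow_natCast, ← Real.rpow_mul (by norm_num), mul_comm, Real.rpow_mul (by norm_num),
      Real.rpow_natCast]
    exact Real.rpow_le_rpow_of_nonpos (by positivity) h1 (by linarith)
  have h4 : (1 / 4 : ℝ) ^ k * v ≤ 4 := by
    rw [one_div, inv_pow, inv_mul_le_iff₀ (by positivity), ← pow_succ]
    linarith
  have h5 : 1 ≤ Real.exp 4 * Real.exp (-(1 / 4 : ℝ) ^ k * v) := by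
    rw [← Real.exp_add, Real.one_le_exp_iff]
    linarith
  calc
    _ ≤ ((4 : ℝ) ^ (-s)) ^ k * 1 := by rwa [mul_one]
    _ ≤ ((4 : ℝ) ^ (-s)) ^ k * (Real.exp 4 * Real.exp (-(1 / 4 : ℝ) ^ k * v)) := by gcongr
    _ = _ := by ring

theorem lintegral_weight_le {s : ℝ} (hs : 0 ≤ s) (g : L2) :
    ∫⁻ x : Space, ENNReal.ofReal ((1 + ‖x‖ ^ 2) ^ (-s)) * ‖g x‖ₑ ^ 2
      ≤ ∑' k : ℕ, ENNReal.ofReal (Real.exp 4 * ((4 : ℝ) ^ (-s)) ^ k) *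
        ‖multiplier (gaussianSymbol ((1 / 4 : ℝ) ^ k) (by positivity)) g‖ₑ ^ 2 := by
  have hg : AEMeasurable (fun x ↦ ‖g x‖ₑ ^ 2) volume := (Lp.aestronglyMeasurable g).enorm.pow_const 2
  have hw (k : ℕ) : Measurable fun x : Space ↦
      ENNReal.ofReal (Real.exp (-(1 / 4 : ℝ) ^ k * ‖x‖ ^ 2)) := by fun_prop
  simp_rw [enorm_sq_multiplier_gaussianSymbol]
  have hc (k : ℕ) : ENNReal.ofReal (Real.exp 4 * ((4 : ℝ) ^ (-s)) ^ k) *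
        ∫⁻ x, ENNReal.ofReal (Real.exp (-(1 / 4 : ℝ) ^ k * ‖x‖ ^ 2)) * ‖g x‖ₑ ^ 2
      = ∫⁻ x, ENNReal.ofReal (Real.exp 4 * ((4 : ℝ) ^ (-s)) ^ k) *
        (ENNReal.ofReal (Real.exp (-(1 / 4 : ℝ) ^ k * ‖x‖ ^ 2)) * ‖g x‖ₑ ^ 2) :=
    (lintegral_const_mul'' _ ((hw k).aemeasurable.mul hg)).symm
  simp_rw [hc]
  have hm (k : ℕ) : AEMeasurable (fun x ↦ ENNReal.ofReal (Real.exp 4 * ((4 : ℝ) ^ (-s)) ^ k) *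
      (ENNReal.ofReal (Real.exp (-(1 / 4 : ℝ) ^ k * ‖x‖ ^ 2)) * ‖g x‖ₑ ^ 2)) volume :=
    ((hw k).aemeasurable.mul hg).const_mul _
  rw [← lintegral_tsum hm]
  refine lintegral_mono fun x ↦ ?_
  obtain ⟨k, hk⟩ := exists_rpow_neg_le_gaussian hs (sq_nonneg ‖x‖)
  refine le_trans ?_ (ENNReal.le_tsum k)
  rw [← mul_assoc, ← ENNReal.ofReal_mul (by positivity)]
  gcongr

theorem lintegral_weight_evolution_le {m s : ℝ} (hm : 0 < m) (hs : 1 < s) (f : L2) :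
    ∫⁻ t : ℝ, ∫⁻ x : Space, ENNReal.ofReal ((1 + ‖x‖ ^ 2) ^ (-s)) *
        ‖(evolutionPart m hm 1 t f + evolutionPart m hm (-1) t f) x‖ₑ ^ 2
      ≤ ENNReal.ofReal (Real.exp 4 * (4 * smoothingConst m) * (1 - (4 : ℝ) ^ (-s) * 4)⁻¹ *
        ‖f‖ ^ 2) := by
  have hC : 0 < smoothingConst m := by
    unfold smoothingConst
    positivity
  have hr0 : 0 ≤ (4 : ℝ) ^ (-s) * 4 := by positivity
  -- The ratio combines the weight `4^(-s)` with the cost `1/l = 4` per dyadic step. Convergence of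
  -- the series is where `s > 1` is essential.
  have hr1 : (4 : ℝ) ^ (-s) * 4 < 1 := by
    have h : (4 : ℝ) ^ (-s) < 4 ^ (-1 : ℝ) :=
      Real.rpow_lt_rpow_of_exponent_lt (by norm_num) (by linarith)
    rw [Real.rpow_neg_one] at h
    linarith
  have hmeas (k : ℕ) : Measurable fun t ↦ ENNReal.ofReal (Real.exp 4 * ((4 : ℝ) ^ (-s)) ^ k) *
        ‖multiplier (gaussianSymbol ((1 / 4 : ℝ) ^ k) (by positivity))
          (evolutionPart m hm 1 t f + evolutionPart m hm (-1) t f)‖ₑ ^ 2 :=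
    ((continuous_enorm.comp ((multiplier _).continuous.comp ((continuous_evolutionPart hm 1 f).add
      (continuous_evolutionPart hm (-1) f)))).measurable.pow_const 2).const_mul _
  calc
    _ ≤ ∫⁻ t, ∑' k : ℕ, ENNReal.ofReal (Real.exp 4 * ((4 : ℝ) ^ (-s)) ^ k) *
        ‖multiplier (gaussianSymbol ((1 / 4 : ℝ) ^ k) (by positivity))
          (evolutionPart m hm 1 t f + evolutionPart m hm (-1) t f)‖ₑ ^ 2 :=
      lintegral_mono fun t ↦ lintegral_weight_le (by linarith) _
    _ = ∑' k : ℕ, ∫⁻ t, ENNReal.ofReal (Real.exp 4 * ((4 : ℝ) ^ (-s)) ^ k) *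
        ‖multiplier (gaussianSymbol ((1 / 4 : ℝ) ^ k) (by positivity))
          (evolutionPart m hm 1 t f + evolutionPart m hm (-1) t f)‖ₑ ^ 2 :=
      lintegral_tsum fun k ↦ (hmeas k).aemeasurable
    _ ≤ ∑' k : ℕ, ENNReal.ofReal (Real.exp 4 * (4 * smoothingConst m) *
          ((4 : ℝ) ^ (-s) * 4) ^ k) * ‖f‖ₑ ^ 2 := by
      refine ENNReal.tsum_le_tsum fun k ↦ ?_
      rw [lintegral_const_mul' _ _ ENNReal.ofReal_ne_top]
      refine (mul_le_mul_right (lintegral_evolution_le hm (by positivity)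
        (pow_le_one₀ (by norm_num) (by norm_num)) f) _).trans_eq ?_
      rw [← mul_assoc, ← ENNReal.ofReal_mul (by positivity)]
      congr 2
      rw [one_div, inv_pow, div_inv_eq_mul, mul_pow]
      ring
    _ = _ := by
      rw [ENNReal.tsum_mul_right, ← ENNReal.ofReal_tsum_of_nonneg (fun k ↦ by positivity)
        ((summable_geometric_of_lt_one hr0 hr1).mul_left _), tsum_mul_left,
        tsum_geometric_of_lt_one hr0 hr1, ← ofReal_norm, ← ENNReal.ofReal_pow (norm_nonneg _),
        ← ENNReal.ofReal_mul]
      have := sub_pos.mpr hr1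
      positivity

end FreeDirac

end

theorem mainTheorem9 (m s : ℝ) (hm : 0 < m) (hs : 1 < s) :
    (∀ u₀ : FreeDirac.L2, ∃! u : ℝ → FreeDirac.L2, FreeDirac.IsDiracSolution m u₀ u) ∧
    ∃ C : ℝ, 0 < C ∧
      ∀ (u₀ : FreeDirac.L2) (u : ℝ → FreeDirac.L2), FreeDirac.IsDiracSolution m u₀ u →
        ∫⁻ t : ℝ, ∫⁻ x : FreeDirac.Space,
            ENNReal.ofReal ((1 + ‖x‖ ^ 2) ^ (-s)) * ‖u t x‖ₑ ^ 2
          ≤ ENNReal.ofReal (C * ‖u₀‖ ^ 2) := by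
  refine ⟨fun u₀ ↦ ⟨_, FreeDirac.isDiracSolution_evolution hm u₀,
    fun v hv ↦ FreeDirac.isDiracSolution_unique hm hv (FreeDirac.isDiracSolution_evolution hm u₀)⟩,
    Real.exp 4 * (4 * FreeDirac.smoothingConst m) * (1 - (4 : ℝ) ^ (-s) * 4)⁻¹, ?_, ?_⟩
  · have h : (4 : ℝ) ^ (-s) < 4 ^ (-1 : ℝ) :=
      Real.rpow_lt_rpow_of_exponent_lt (by norm_num) (by linarith)
    rw [Real.rpow_neg_one] at h
    have h1 : 0 < 1 - (4 : ℝ) ^ (-s) * 4 := by linarith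
    unfold FreeDirac.smoothingConst
    positivity
  · intro u₀ u hu
    -- Uniqueness identifies any solution with the explicit evolution, for which the estimate has
    -- been proved.
    rw [FreeDirac.isDiracSolution_unique hm hu (FreeDirac.isDiracSolution_evolution hm u₀)]
    exact FreeDirac.lintegral_weight_evolution_le hm hs u₀
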